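/- **Lemma (energy conservation for Euler-$\alpha$).** Let $n\in\{2,3\}$, let $\mathbb T^n=(\mathbb R/L\mathbb Z)^n$ with $L>0$, and let $\alpha>0$, $0<T<\infty$ and $s>1$. Let $u\in C^0([0,T);H^1(\mathbb T^n;\mathbb R^n))$ be a mean-zero weak solution of the Euler-$\alpha$ equations $$\partial_t v+u\cdot\nabla v+v^j\nabla u^j+\nabla p=0,\qquad \operatorname{div}u=0,\qquad v=u-\alpha^2\Delta u,$$ that is: for every $t\in[0,T)$ the field $u(\cdot,t)$ is weakly divergence free and has zero mean, and for every divergence-free $\varphi\in C_c^\infty((0,T)\times\mathbb T^n;\mathbb R^n)$ (summing over repeated indices) $$\int_0^T\!\!\int_{\mathbb T^n}\Big[\partial_t\varphi^l u^l+\alpha^2\,\partial_k\partial_t\varphi^l\,\partial_k u^l+\partial_k\varphi^l\big(u^ku^l-\alpha^2\partial_ku^j\partial_lu^j+\alpha^2\partial_ju^k\partial_ju^l\big)+\alpha^2u^k\,\partial_k\partial_j\varphi^l\,\partial_ju^l\Big]dx\,dt=0 .$$ If in addition $u\in L^3([0,T);B^s_{3,\infty}(\mathbb T^n))$, then $$\mathcal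 H_\alpha(t)=\|u(t)\|_{L^2}^2+\alpha^2\|\nabla u(t)\|_{L^2}^2$$ is constant on $[0,T)$. Here $B^s_{3,\infty}$ is the Besov space with norm $\|f\|_{L^3}+\sup_{h\ne0}|h|^{-s}\|\Delta_h^{m}f\|_{L^3}$, where $m=\lfloor s\rfloor+1$ and $\Delta_hf=f(\cdot+h)-f$. -/

import Mathlib

open MeasureTheory Filter Topology Set
open scoped ContDiff ENNReal

noncomputable section

namespace EulerAlpha

/-- The flat torus `𝕋ⁿ = (ℝ / Lℤ)ⁿ` of period `L` in each direction. -/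
abbrev Torus (L : ℝ) (n : ℕ) : Type := Fin n → AddCircle L

/-- Vectors of `ℝⁿ` with the Euclidean norm. -/
abbrev Vec (n : ℕ) : Type := EuclideanSpace ℝ (Fin n)

variable {L : ℝ} {n : ℕ}

/-- The covering map `ℝⁿ → 𝕋ⁿ`. -/
def proj (L : ℝ) {n : ℕ} (y : Vec n) : Torus L n := fun i => ((y i : ℝ) : AddCircle L)

/-- `k`-th classical partial derivative of a function on the torus. -/
def pderiv (k : Fin n) (f : Torus L n → ℝ) (x : Torus L n) : ℝ :=
  deriv (fun r : ℝ => f (x + Pi.single k (r : AddCircle L))) 0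

/-- `C^∞` real functions on the torus: those whose periodic lift to `ℝⁿ` is `C^∞`. -/
def IsSmooth (f : Torus L n → ℝ) : Prop :=
  ContDiff ℝ ∞ (fun y : Vec n => f (proj L y))

/-- Smooth, divergence-free vector fields on `(0, T) × 𝕋ⁿ` with compact support in time. -/
structure IsTestField (T : ℝ) (φ : ℝ → Torus L n → Vec n) : Prop where
  smooth : ContDiff ℝ ∞ (fun z : ℝ × Vec n => φ z.1 (proj L z.2))
  compact_support : ∃ a b : ℝ, 0 < a ∧ b < T ∧ ∀ t : ℝ, t ∉ Icc a b → ∀ x, φ t x = 0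
  div_free : ∀ t x, ∑ i, pderiv i (fun y => φ t y i) x = 0

variable [Fact (0 < L)]

/-- `g` is the `k`-th weak (distributional) partial derivative of `f` on the torus. -/
def IsWeakPartial (k : Fin n) (f g : Torus L n → ℝ) : Prop :=
  ∀ ψ : Torus L n → ℝ, IsSmooth ψ → ∫ x, f x * pderiv k ψ x = - ∫ x, g x * ψ x

open Classical in
/-- The square-integrable weak partial derivative `∂ₖ f` (unique up to null sets);
by convention `0` if there is none. -/
def weakPartial (k : Fin n) (f : Torus L n → ℝ) : Torus L n → ℝ :=
  if h : ∃ g : Torus L n → ℝ, MemLp g 2 volume ∧ IsWeakPartial k f g then h.choose else 0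

/-- `∂ₖ fⁱ` for a vector field `f`. -/
def grad (f : Torus L n → Vec n) (k i : Fin n) : Torus L n → ℝ :=
  weakPartial k (fun x => f x i)

/-- Vector fields of class `H¹(𝕋ⁿ)`: `f` and all its weak partial derivatives are in `L²`. -/
def MemH1 (f : Torus L n → Vec n) : Prop :=
  MemLp f 2 volume ∧
    ∀ k i, ∃ g : Torus L n → ℝ, MemLp g 2 volume ∧ IsWeakPartial k (fun x => f x i) g

/-- The `H¹` norm of a vector field of class `H¹`. -/
def h1Norm (f : Torus L n → Vec n) : ℝ≥0∞ :=
  eLpNorm f 2 volume + ∑ k, ∑ i, eLpNorm (grad f k i) 2 volume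

/-- `u ∈ C⁰([0, T); H¹(𝕋ⁿ))`. -/
def IsContinuousH1 (T : ℝ) (u : ℝ → Torus L n → Vec n) : Prop :=
  (∀ t ∈ Ico 0 T, MemH1 (u t)) ∧
    ∀ t₀ ∈ Ico 0 T,
      Tendsto (fun t => h1Norm (fun x => u t x - u t₀ x)) (𝓝[Ico 0 T] t₀) (𝓝 0)

/-- Weakly divergence free: orthogonal to all smooth gradients. -/
def IsWeaklyDivFree (f : Torus L n → Vec n) : Prop :=
  ∀ ψ : Torus L n → ℝ, IsSmooth ψ → ∫ x, ∑ i, f x i * pderiv i ψ x = 0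

/-- The space integral in the weak formulation of the Euler-`α` equations, at a fixed time, where
`f` is the velocity, `φ` the test field and `φt` the time derivative of the test field:
`∫ φt · f + α² ∇φt : ∇f + ∂ₖφˡ (fᵏ fˡ - α² ∂ₖfʲ ∂ₗfʲ + α² ∂ⱼfᵏ ∂ⱼfˡ) + α² fᵏ ∂ₖ∂ⱼφˡ ∂ⱼfˡ`.
The last two `α²` terms are the pairing of `fᵏ ∂ₖφˡ ∈ H¹` with `-α² Δfˡ ∈ H⁻¹`. -/
def weakIntegral (α : ℝ) (f φ φt : Torus L n → Vec n) : ℝ :=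
  ∫ x, ((∑ l, φt x l * f x l)
    + α ^ 2 * (∑ k, ∑ l, pderiv k (fun y => φt y l) x * grad f k l x)
    + (∑ k, ∑ l, pderiv k (fun y => φ y l) x *
        (f x k * f x l
          - α ^ 2 * (∑ j, grad f k j x * grad f l j x)
          + α ^ 2 * (∑ j, grad f j k x * grad f j l x)))
    + α ^ 2 * (∑ k, ∑ j, ∑ l,
        f x k * pderiv k (pderiv j (fun y => φ y l)) x * grad f j l x))

/-- Weak solutions of the Euler-`α` equations on `[0, T) × 𝕋ⁿ`. -/
structure IsWeakSolution (α T : ℝ) (u : ℝ → Torus L n → Vec n) : Prop where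
  continuous_h1 : IsContinuousH1 T u
  div_free : ∀ t ∈ Ico 0 T, IsWeaklyDivFree (u t)
  mean_zero : ∀ t ∈ Ico 0 T, ∫ x, u t x = 0
  equation : ∀ φ : ℝ → Torus L n → Vec n, IsTestField T φ →
    ∫ t in Ioo 0 T, weakIntegral α (u t) (φ t) (fun x => deriv (fun r => φ r x) t) = 0

/-- The norm of the Besov space `B^s_{p,∞}(𝕋ⁿ)`, `s > 0`, through the modulus of smoothness of
order `m = ⌊s⌋ + 1 > s`:
`‖f‖_{L^p} + sup_{h ≠ 0} |h|^{-s} ‖Δ_h^m f‖_{L^p}`, where `Δ_h f = f(· + h) - f`.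
It is `∞` for measurable `f` outside the space. -/
def besovNorm (s : ℝ) (p : ℝ≥0∞) (f : Torus L n → Vec n) : ℝ≥0∞ :=
  eLpNorm f p volume +
    ⨆ (h : Vec n) (_ : h ≠ 0),
      eLpNorm ((fwdDiff (proj L h))^[⌊s⌋₊ + 1] f) p volume / ENNReal.ofReal (‖h‖ ^ s)

/-- `u ∈ L³([0, T); B^s_{3,∞}(𝕋ⁿ))`, for `u` whose time slices are measurable. -/
def MemL3Besov (T s : ℝ) (u : ℝ → Torus L n → Vec n) : Prop :=
  ∫⁻ t in Ico 0 T, besovNorm s 3 (u t) ^ 3 < ⊤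

/-- The Hamiltonian `‖f‖²_{L²} + α² ‖∇f‖²_{L²}`. -/
def hamiltonian (α : ℝ) (f : Torus L n → Vec n) : ℝ :=
  (∫ x, ‖f x‖ ^ 2) + α ^ 2 * ∫ x, ∑ k, ∑ i, grad f k i x ^ 2

end EulerAlpha

end

/-!
Energy conservation holds because the only obstruction, the flux of energy through small scales,
is trilinear in a velocity with one derivative in `L³`.

The equation is tested with averages `ρ * u` of the solution itself, where `ρ` is an even
mollifier. Averages are written as integrals over `ℝⁿ` of translates (`avg`), so that no
periodization of `ρ` is needed and every pairing reduces, by Fubini, to integrals of correlations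
`∫ f(x) g(x + z) dx` against `ρ(z)` or `∂ₖρ(z)` (`IsKernel.integral_mul_avg`). As the energy form
`energy α ρ f f'` is symmetric, the equation for `η(t) (ρ * u(q))` with `q` frozen gives
`d/dt energy(u, u) = 2 flux(u, u)` without any regularization in time
(`IsMollifier.hasDerivAt_energy`).

The flux consists of two kinds of terms (`IsMollifier.flux_diag`). The transport terms
`∑ₖ ∫ uᵏ w (∂ₖρ * w)`, with `w` a component of `u` or of `∇u`, are commutators: by the oddness of
`∂ₖρ` and by `div u = 0` they equal integrals of `∂ₖρ(z) (τ_z uᵏ - uᵏ) w (w - τ_z w)`, up to a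
factor, so a velocity that is Lipschitz in the mean of order `3` compensates the derivative of `ρ`,
and the continuity of translations in `L³` makes the rest small
(`IsMollifier.abs_sum_tri_dker_le`). The terms cubic in `∇u` converge, and their limits cancel
algebraically (`sum_cubic_eq_zero`).

The Besov hypothesis with `s > 1` enters only through a Marchaud inequality
(`exists_lipschitz_besov`), which gives the Lipschitz bound in `L³`, and through its consequence
`∇u ∈ L³` (`eLpNorm_weakPartial_le`). Both bounds are linear in the Besov norm, so its cube
dominates the flux; the Besov norm is measurable in time because it is lower semicontinuous along
a curve that is continuous in `L²` (`IsContinuousH1.aemeasurable_besovNorm`).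
-/

open MeasureTheory Filter Topology Set
open scoped ContDiff ENNReal

noncomputable section

namespace EulerAlpha

/-! ### The covering map of the torus -/

section Covering

variable {L : ℝ} {n : ℕ}

theorem proj_add (y z : Vec n) : proj L (y + z) = proj L y + proj L z := by
  ext i; simp [proj]

theorem proj_neg (z : Vec n) : proj L (-z) = -proj L z := by
  ext i; simp [proj]

theorem proj_zero : proj L (0 : Vec n) = 0 := by
  ext i; simp [proj]

theorem proj_smul_single (k : Fin n) (r : ℝ) :
    proj L (r • (EuclideanSpace.single k 1 : Vec n)) = Pi.single k (r : AddCircle L) := by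
  ext i
  by_cases h : i = k
  · subst h; simp [proj]
  · simp [proj, h]

theorem continuous_proj : Continuous (proj L : Vec n → Torus L n) := by
  refine continuous_pi fun i => ?_
  exact (AddCircle.continuous_mk' L).comp (by fun_prop)

theorem isOpenQuotientMap_proj : IsOpenQuotientMap (proj L : Vec n → Torus L n) := by
  have h1 : IsOpenQuotientMap
      (Pi.map (fun _ : Fin n => fun r : ℝ => (r : AddCircle L))) :=
    IsOpenQuotientMap.piMap fun _ => QuotientAddGroup.isOpenQuotientMap_mk
  exact h1.comp (EuclideanSpace.equiv (Fin n) ℝ).toHomeomorph.isOpenQuotientMap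

/-- A fundamental domain of the covering map, centred at the origin. -/
def cube (L : ℝ) (n : ℕ) : Set (Vec n) := {z | ∀ i, z i ∈ Ioc (-(L / 2)) (L / 2)}

theorem mem_cube_of_norm_lt {z : Vec n} (h : ‖z‖ < L / 2) : z ∈ cube L n := by
  intro i
  have h1 : |z i| ≤ ‖z‖ := by
    simpa using PiLp.norm_apply_le z i
  have h2 := abs_le.1 (h1.trans h.le)
  have h3 := abs_lt.1 (h1.trans_lt h)
  exact ⟨h3.1, h2.2⟩

theorem measurableSet_cube : MeasurableSet (cube L n) := by
  have : cube L n = ⋂ i, (fun z : Vec n => z i) ⁻¹' Ioc (-(L / 2)) (L / 2) := by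
    ext z; simp [cube]
  rw [this]
  refine MeasurableSet.iInter fun i => ?_
  exact (by fun_prop : Continuous fun z : Vec n => z i).measurable measurableSet_Ioc

variable [Fact (0 < L)]

theorem measurePreserving_proj :
    MeasurePreserving (proj L : Vec n → Torus L n) (volume.restrict (cube L n)) volume := by
  have h1 : MeasurePreserving (fun (a : Fin n → ℝ) (i : Fin n) => ((a i : ℝ) : AddCircle L))
      (Measure.pi fun _ => volume.restrict (Ioc (-(L / 2)) (-(L / 2) + L)))
      (Measure.pi fun _ => volume) :=
    measurePreserving_pi _ _ (fun _ => AddCircle.measurePreserving_mk L (-(L / 2)))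
  rw [← Measure.restrict_pi_pi] at h1
  have h2 := (EuclideanSpace.volume_preserving_symm_measurableEquiv_toLp (Fin n)).restrict_preimage
    (s := Set.pi Set.univ fun _ => Ioc (-(L / 2)) (-(L / 2) + L))
    (MeasurableSet.univ_pi fun _ => measurableSet_Ioc)
  have h3 := h1.comp h2
  have e : cube L n = (MeasurableEquiv.toLp 2 (Fin n → ℝ)).symm ⁻¹'
      (Set.pi Set.univ fun _ => Ioc (-(L / 2)) (-(L / 2) + L)) := by
    ext z
    rw [show -(L / 2) + L = L / 2 by ring]
    exact ⟨fun h i _ => h i, fun h i => h i (mem_univ i)⟩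
  rw [e]
  exact h3

theorem measurePreserving_translate (a : Torus L n) :
    MeasurePreserving (fun x : Torus L n => x + a) volume volume :=
  measurePreserving_add_right volume a

/-- The evaluation `(z, x) ↦ x + z` of translations respects null sets. -/
theorem quasiMeasurePreserving_translate :
    Measure.QuasiMeasurePreserving (fun q : Vec n × Torus L n => q.2 + proj L q.1)
      (volume.prod volume) volume := by
  have hm : Measurable fun q : Vec n × Torus L n => q.2 + proj L q.1 :=
    (continuous_snd.add (continuous_proj.comp continuous_fst)).measurable
  have h : MeasurePreserving (fun q : Vec n × Torus L n => (q.1, q.2 + proj L q.1))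
      (volume.prod volume) (volume.prod volume) :=
    (MeasurePreserving.id volume).skew_product (g := fun z x => x + proj L z) hm
      (Eventually.of_forall fun z => (measurePreserving_translate (proj L z)).map_eq)
  exact Measure.quasiMeasurePreserving_snd.comp h.quasiMeasurePreserving

theorem aestronglyMeasurable_translate {E : Type*} [TopologicalSpace E] {f : Torus L n → E}
    (hf : AEStronglyMeasurable f volume) (a : Torus L n) :
    AEStronglyMeasurable (fun x => f (x + a)) volume :=
  hf.comp_measurePreserving (measurePreserving_translate a)

theorem integrable_translate {f : Torus L n → ℝ} (hf : Integrable f volume) (a : Torus L n) :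
    Integrable (fun x => f (x + a)) volume :=
  (measurePreserving_translate a).integrable_comp_of_integrable hf

theorem eLpNorm_translate {E : Type*} [NormedAddCommGroup E] {f : Torus L n → E}
    (hf : AEStronglyMeasurable f volume) (p : ℝ≥0∞) (a : Torus L n) :
    eLpNorm (fun x => f (x + a)) p volume = eLpNorm f p volume :=
  eLpNorm_comp_measurePreserving hf (measurePreserving_translate a)

theorem memLp_translate {E : Type*} [NormedAddCommGroup E] {f : Torus L n → E} {p : ℝ≥0∞}
    (hf : MemLp f p volume) (a : Torus L n) : MemLp (fun x => f (x + a)) p volume :=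
  hf.comp_measurePreserving (measurePreserving_translate a)

theorem integrableOn_cube_comp_proj {f : Torus L n → ℝ} (hf : Integrable f volume)
    (x : Torus L n) : IntegrableOn (fun z => f (x + proj L z)) (cube L n) volume := by
  have h := integrable_translate hf x
  have h2 := measurePreserving_proj.integrable_comp_of_integrable h
  simpa [IntegrableOn, Function.comp_def, add_comm] using h2

theorem integral_cube_comp_proj (f : Torus L n → ℝ) (hf : AEStronglyMeasurable f volume)
    (x : Torus L n) : ∫ z in cube L n, f (x + proj L z) = ∫ y, f y := by
  have h := aestronglyMeasurable_translate hf x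
  have e := measurePreserving_proj (L := L) (n := n)
  rw [← integral_add_right_eq_self f x, ← e.map_eq,
    integral_map e.aemeasurable (by rw [e.map_eq]; exact h)]
  simp only [add_comm]

theorem locallyIntegrable_comp_proj {f : Torus L n → ℝ} (hf : Integrable f volume)
    (x : Torus L n) : LocallyIntegrable (fun z : Vec n => f (x + proj L z)) volume := by
  intro y
  have hL : 0 < L := Fact.out
  refine ⟨Metric.ball y (L / 2), Metric.ball_mem_nhds _ (by positivity), ?_⟩
  have h1 := integrableOn_cube_comp_proj hf (x + proj L y)
  have h2 : MeasurePreserving (fun z : Vec n => z - y) volume volume :=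
    measurePreserving_sub_right volume y
  have h3 := (h2.integrableOn_comp_preimage
    (MeasurableEquiv.subRight y).measurableEmbedding).2 h1
  refine (h3.congr_fun_ae (Eventually.of_forall fun z => ?_)).mono_set (fun z hz => ?_)
  · simp only [Function.comp_def, add_assoc, ← proj_add, add_sub_cancel]
  · exact mem_cube_of_norm_lt (by simpa [dist_eq_norm] using hz)

end Covering

/-! ### Averages of translates -/

section Averages

variable {L : ℝ} {n : ℕ}

/-- Kernels on `ℝⁿ`: continuous functions supported in a ball of radius less than `L / 2`, on which
the covering map is injective. -/
structure IsKernel (L : ℝ) (K : Vec n → ℝ) : Prop where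
  continuous : Continuous K
  support : ∃ δ < L / 2, ∀ z, δ ≤ ‖z‖ → K z = 0

/-- The average `∫ K(z) f(· + z) dz` of the translates of `f` with weight `K`: the convolution of
`f` with the reflection of `K`, written as an integral over `ℝⁿ` rather than over the torus. -/
def avg (K : Vec n → ℝ) (f : Torus L n → ℝ) (x : Torus L n) : ℝ :=
  ∫ z, K z * f (x + proj L z)

variable {K : Vec n → ℝ}

theorem IsKernel.eq_zero (hK : IsKernel L K) {z : Vec n} (hz : L / 2 ≤ ‖z‖) : K z = 0 := by
  obtain ⟨δ, hδ, h⟩ := hK.support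
  exact h z (hδ.le.trans hz)

theorem IsKernel.hasCompactSupport (hK : IsKernel L K) : HasCompactSupport K := by
  refine HasCompactSupport.intro (isCompact_closedBall (0 : Vec n) (L / 2)) fun z hz => ?_
  exact hK.eq_zero (by simpa using (not_le.1 (by simpa using hz)).le)

theorem IsKernel.integrable (hK : IsKernel L K) : Integrable K volume :=
  hK.continuous.integrable_of_hasCompactSupport hK.hasCompactSupport

theorem IsKernel.exists_bound (hK : IsKernel L K) : ∃ c, 0 ≤ c ∧ ∀ z, |K z| ≤ c := by
  obtain ⟨c, hc⟩ := hK.hasCompactSupport.exists_bound_of_continuous hK.continuous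
  exact ⟨c, (norm_nonneg _).trans (hc 0), hc⟩

theorem IsKernel.neg (hK : IsKernel L K) : IsKernel L (fun z => K (-z)) where
  continuous := hK.continuous.comp continuous_neg
  support := by
    obtain ⟨δ, hδ, h⟩ := hK.support
    exact ⟨δ, hδ, fun z hz => h _ (by rwa [norm_neg])⟩

theorem IsKernel.eq_indicator_cube (hK : IsKernel L K) (F : Vec n → ℝ) :
    (fun z => K z * F z) = (cube L n).indicator fun z => K z * F z := by
  ext z
  by_cases h : z ∈ cube L n
  · rw [indicator_of_mem h]
  · rw [indicator_of_notMem h, hK.eq_zero (not_lt.1 fun h' => h (mem_cube_of_norm_lt h')),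
      zero_mul]

variable [Fact (0 < L)] {f g : Torus L n → ℝ}

theorem IsKernel.integrable_mul (hK : IsKernel L K) (hf : Integrable f volume) (x : Torus L n) :
    Integrable (fun z => K z * f (x + proj L z)) volume := by
  obtain ⟨c, -, hc⟩ := hK.exists_bound
  rw [hK.eq_indicator_cube, integrable_indicator_iff measurableSet_cube]
  exact (integrableOn_cube_comp_proj hf x).bdd_mul hK.continuous.aestronglyMeasurable
    (Eventually.of_forall hc)

theorem IsKernel.integral_abs_le (hK : IsKernel L K) {c : ℝ} (hc : ∀ z, |K z| ≤ c)
    (hf : Integrable f volume) (x : Torus L n) :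
    ∫ z, |K z * f (x + proj L z)| ≤ c * ∫ y, |f y| := by
  have h1 : ∫ z, |K z * f (x + proj L z)| = ∫ z in cube L n, |K z * f (x + proj L z)| := by
    rw [← integral_indicator measurableSet_cube]
    congr 1
    ext z
    rw [congrFun (hK.eq_indicator_cube fun z => f (x + proj L z)) z]
    by_cases h : z ∈ cube L n <;> simp [h]
  rw [h1, ← integral_cube_comp_proj (fun y => |f y|) hf.abs.aestronglyMeasurable x,
    ← integral_const_mul]
  refine integral_mono (hK.integrable_mul hf x).abs.integrableOn
    ((integrableOn_cube_comp_proj hf.abs x).const_mul c) fun z => ?_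
  simp only [abs_mul]
  exact mul_le_mul_of_nonneg_right (hc z) (abs_nonneg _)

theorem IsKernel.abs_avg_le (hK : IsKernel L K) {c : ℝ} (hc : ∀ z, |K z| ≤ c)
    (hf : Integrable f volume) (x : Torus L n) : |avg K f x| ≤ c * ∫ y, |f y| :=
  (abs_integral_le_integral_abs).trans (hK.integral_abs_le hc hf x)

theorem IsKernel.avg_sub (hK : IsKernel L K) (hf : Integrable f volume)
    (hg : Integrable g volume) (x : Torus L n) :
    avg K (fun y => f y - g y) x = avg K f x - avg K g x := by
  simp only [avg, mul_sub]
  exact integral_sub (hK.integrable_mul hf x) (hK.integrable_mul hg x)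

theorem IsKernel.integrable_prod (hK : IsKernel L K) (hf : Integrable f volume)
    (hg : Integrable g volume) :
    Integrable (fun q : Vec n × Torus L n => K q.1 * (f q.2 * g (q.2 + proj L q.1)))
      (volume.prod volume) := by
  have hm : AEStronglyMeasurable
      (fun q : Vec n × Torus L n => K q.1 * (f q.2 * g (q.2 + proj L q.1)))
      (volume.prod volume) :=
    (hK.continuous.comp continuous_fst).aestronglyMeasurable.mul
      (hf.aestronglyMeasurable.comp_snd.mul
        (hg.aestronglyMeasurable.comp_quasiMeasurePreserving quasiMeasurePreserving_translate))
  obtain ⟨c, hc0, hc⟩ := hK.exists_bound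
  have e : ∀ x z, K z * (f x * g (x + proj L z)) = f x * (K z * g (x + proj L z)) :=
    fun x z => by ring
  refine (integrable_prod_iff' hm).2 ⟨Eventually.of_forall fun x => ?_, ?_⟩
  · simp only [e]
    exact (hK.integrable_mul hg x).const_mul _
  · refine Integrable.mono' (hf.abs.mul_const (c * ∫ y, |g y|)) hm.norm.prod_swap.integral_prod_right'
      (Eventually.of_forall fun x => ?_)
    rw [Real.norm_eq_abs, abs_of_nonneg (integral_nonneg fun z => norm_nonneg _)]
    simp only [e, norm_mul (f x), integral_const_mul, Real.norm_eq_abs]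
    exact mul_le_mul_of_nonneg_left (hK.integral_abs_le hc hg x) (abs_nonneg _)

/-- Fubini: averages are paired with a function by averaging the correlations. -/
theorem IsKernel.integral_mul_avg (hK : IsKernel L K) (hf : Integrable f volume)
    (hg : Integrable g volume) :
    ∫ x, f x * avg K g x = ∫ z, K z * ∫ x, f x * g (x + proj L z) := by
  simp only [avg, ← integral_const_mul]
  rw [integral_integral_swap]
  · congr 1; ext x; congr 1; ext y; ring
  · have := (hK.integrable_prod hf hg).swap
    refine this.congr (Eventually.of_forall fun q => ?_)
    simp only [Function.comp_def, Function.uncurry, Prod.swap]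
    ring

theorem IsKernel.integrable_corr (hK : IsKernel L K) (hf : Integrable f volume)
    (hg : Integrable g volume) :
    Integrable (fun z => K z * ∫ x, f x * g (x + proj L z)) volume := by
  have := (hK.integrable_prod hf hg).integral_prod_left
  simpa only [integral_const_mul] using this

theorem integral_mul_translate_neg (f g : Torus L n → ℝ) (z : Vec n) :
    ∫ x, f x * g (x + proj L (-z)) = ∫ x, f (x + proj L z) * g x := by
  rw [← integral_add_right_eq_self _ (proj L z)]
  simp [proj_neg]

theorem IsKernel.integral_mul_avg_comm (hK : IsKernel L K) (hf : Integrable f volume)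
    (hg : Integrable g volume) :
    ∫ x, f x * avg K g x = ∫ x, g x * avg (fun z => K (-z)) f x := by
  rw [hK.integral_mul_avg hf hg, hK.neg.integral_mul_avg hg hf, ← integral_neg_eq_self]
  congr 1; ext z
  rw [integral_mul_translate_neg]
  simp only [mul_comm]

end Averages

/-! ### Smoothness of averages and weak derivatives -/

section Smoothing

variable {L : ℝ} {n : ℕ}

/-- The classical partial derivative `∂ₖ K` on `ℝⁿ`. -/
def dker (k : Fin n) (K : Vec n → ℝ) (z : Vec n) : ℝ :=
  fderiv ℝ K z (EuclideanSpace.single k 1)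

variable {K : Vec n → ℝ}

theorem contDiff_dker (hK : ContDiff ℝ ∞ K) (k : Fin n) : ContDiff ℝ ∞ (dker k K) :=
  (hK.fderiv_right (m := ∞) (by simp)).clm_apply contDiff_const

theorem IsKernel.dker (hK : IsKernel L K) (hs : ContDiff ℝ ∞ K) (k : Fin n) :
    IsKernel L (dker k K) where
  continuous := (contDiff_dker hs k).continuous
  support := by
    obtain ⟨δ, hδ, h⟩ := hK.support
    refine ⟨(δ + L / 2) / 2, by linarith, fun z hz => ?_⟩
    have h1 : K =ᶠ[𝓝 z] fun _ => 0 := by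
      have : {w : Vec n | δ < ‖w‖} ∈ 𝓝 z :=
        (isOpen_lt continuous_const continuous_norm).mem_nhds (by
          change δ < ‖z‖
          linarith)
      filter_upwards [this] with w hw using h w hw.le
    simp [EulerAlpha.dker, h1.fderiv_eq]

theorem dker_neg_apply (hs : ContDiff ℝ ∞ K) (k : Fin n) (z : Vec n) :
    EulerAlpha.dker k (fun w => K (-w)) z = -EulerAlpha.dker k K (-z) := by
  have h := (hs.differentiable (by simp)).differentiableAt (x := -z)
  have h2 := h.hasFDerivAt.comp z (hasFDerivAt_id z).neg
  have h3 : fderiv ℝ (fun w => K (-w)) z = _ := h2.fderiv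
  simp [EulerAlpha.dker, h3]

theorem dker_odd (hs : ContDiff ℝ ∞ K) (he : ∀ z, K (-z) = K z) (k : Fin n) (z : Vec n) :
    EulerAlpha.dker k K (-z) = -EulerAlpha.dker k K z := by
  have := dker_neg_apply hs k z
  simp only [he] at this
  linarith

theorem integral_mul_add_eq_convolution (K F : Vec n → ℝ) (y : Vec n) :
    ∫ z, K z * F (z + y) =
      (MeasureTheory.convolution F (fun w => K (-w)) (ContinuousLinearMap.mul ℝ ℝ) volume) y := by
  rw [convolution_def,
    ← integral_add_right_eq_self (fun t => ContinuousLinearMap.mul ℝ ℝ (F t) (K (-(y - t)))) y]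
  congr 1; ext z
  simp [mul_comm]

theorem IsKernel.contDiff_integral (hK : IsKernel L K) (hs : ContDiff ℝ ∞ K) {F : Vec n → ℝ}
    (hF : LocallyIntegrable F volume) : ContDiff ℝ ∞ fun y => ∫ z, K z * F (z + y) := by
  simp only [integral_mul_add_eq_convolution]
  exact hK.neg.hasCompactSupport.contDiff_convolution_right _ hF (hs.comp contDiff_neg)

theorem IsKernel.hasDerivAt_integral (hK : IsKernel L K) (hs : ContDiff ℝ ∞ K) {F : Vec n → ℝ}
    (hF : LocallyIntegrable F volume) (k : Fin n) :
    HasDerivAt (fun r : ℝ => ∫ z, K z * F (z + r • EuclideanSpace.single k 1))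
      (-∫ z, EulerAlpha.dker k K z * F z) 0 := by
  have hs' : ContDiff ℝ 1 fun w => K (-w) := (hs.comp contDiff_neg).of_le (by simp)
  have h := hK.neg.hasCompactSupport.hasFDerivAt_convolution_right
    (ContinuousLinearMap.mul ℝ ℝ) hF hs' (0 : Vec n)
  have hline : HasDerivAt (fun r : ℝ => r • (EuclideanSpace.single k 1 : Vec n))
      (EuclideanSpace.single k 1) 0 := by
    simpa using (hasDerivAt_id (0 : ℝ)).smul_const (EuclideanSpace.single k 1 : Vec n)
  have h2 := HasFDerivAt.comp_hasDerivAt_of_eq (0 : ℝ) h hline (by simp)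
  have e : ∀ y, ∫ z, K z * F (z + y) = _ := integral_mul_add_eq_convolution K F
  simp only [e]
  refine h2.congr_deriv ?_
  rw [convolution_precompR_apply _ hF (hK.neg.hasCompactSupport.fderiv (𝕜 := ℝ))
    (hs'.continuous_fderiv (by simp))]
  have e2 := integral_mul_add_eq_convolution (EulerAlpha.dker k K) F 0
  simp only [add_zero] at e2
  rw [e2, convolution_def, convolution_def, ← integral_neg]
  congr 1; ext t
  have h3 := dker_neg_apply hs k (0 - t)
  simp only [EulerAlpha.dker, zero_sub, neg_neg] at h3 ⊢
  simp [h3]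

theorem avg_proj (K : Vec n → ℝ) (f : Torus L n → ℝ) (y : Vec n) :
    avg K f (proj L y) = ∫ z, K z * (fun z => f (0 + proj L z)) (z + y) := by
  simp only [zero_add, proj_add, avg, add_comm (proj L y)]

theorem IsSmooth.continuous {ψ : Torus L n → ℝ} (h : IsSmooth ψ) : Continuous ψ :=
  isOpenQuotientMap_proj.isQuotientMap.continuous_iff.2 (ContDiff.continuous h)

variable [Fact (0 < L)] {f g : Torus L n → ℝ}

theorem IsKernel.contDiff_avg (hK : IsKernel L K) (hs : ContDiff ℝ ∞ K)
    (hf : Integrable f volume) : ContDiff ℝ ∞ fun y : Vec n => avg K f (proj L y) := by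
  rw [funext (avg_proj K f)]
  exact hK.contDiff_integral hs (locallyIntegrable_comp_proj hf 0)

theorem IsKernel.isSmooth_avg (hK : IsKernel L K) (hs : ContDiff ℝ ∞ K)
    (hf : Integrable f volume) : IsSmooth (avg K f) :=
  hK.contDiff_avg hs hf

theorem IsKernel.continuous_avg (hK : IsKernel L K) (hf : Integrable f volume) :
    Continuous (avg K f) := by
  refine isOpenQuotientMap_proj.isQuotientMap.continuous_iff.2 ?_
  have e : avg K f ∘ proj L = MeasureTheory.convolution (fun z => f (0 + proj L z))
      (fun w => K (-w)) (ContinuousLinearMap.mul ℝ ℝ) volume := by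
    ext y
    rw [Function.comp_apply, avg_proj]
    exact integral_mul_add_eq_convolution K (fun z => f (0 + proj L z)) y
  rw [e]
  exact hK.neg.hasCompactSupport.continuous_convolution_right _
    (locallyIntegrable_comp_proj hf 0) hK.neg.continuous

theorem IsKernel.pderiv_avg (hK : IsKernel L K) (hs : ContDiff ℝ ∞ K)
    (hf : Integrable f volume) (k : Fin n) :
    pderiv k (avg K f) = fun x => -avg (EulerAlpha.dker k K) f x := by
  ext x
  have h := hK.hasDerivAt_integral hs (locallyIntegrable_comp_proj hf x) k
  refine Eq.trans ?_ h.deriv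
  simp only [pderiv, avg, proj_add, proj_smul_single]
  congr 1; ext r; congr 1; ext z
  rw [add_right_comm, add_assoc]

/-- A continuous function on the torus that pairs to zero with every integrable function vanishes. -/
theorem eq_zero_of_integral_mul_eq_zero {F : Torus L n → ℝ} (hF : Continuous F)
    (h : ∀ χ : Torus L n → ℝ, Integrable χ volume → ∫ x, χ x * F x = 0) : F = 0 := by
  obtain ⟨c, hc⟩ : ∃ c, ∀ x, ‖F x‖ ≤ c := by
    obtain ⟨c, hc⟩ := isCompact_univ.exists_bound_of_continuousOn hF.continuousOn
    exact ⟨c, fun x => hc x (mem_univ x)⟩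
  have hi : Integrable F volume :=
    Integrable.of_bound hF.aestronglyMeasurable c (Eventually.of_forall hc)
  have h1 := h F hi
  have h2 : (fun x => F x * F x) =ᵐ[volume] 0 :=
    (integral_eq_zero_iff_of_nonneg (fun x => mul_self_nonneg _)
      (hi.bdd_mul hF.aestronglyMeasurable (Eventually.of_forall hc))).1 h1
  have h3 : (fun x => F x * F x) = 0 :=
    (Continuous.ae_eq_iff_eq volume (hF.mul hF) continuous_const).1 h2
  ext x
  simpa using congrFun h3 x

/-- Averaging a weak partial derivative amounts to averaging the function with the
differentiated kernel. The periodic test function needed to see this is itself an average. -/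
theorem IsKernel.avg_dker (hK : IsKernel L K) (hs : ContDiff ℝ ∞ K)
    (hf : Integrable f volume) (hg : Integrable g volume) {k : Fin n}
    (hfg : IsWeakPartial k f g) : avg (EulerAlpha.dker k K) f = fun x => -avg K g x := by
  have hd := hK.dker hs k
  have key : (fun x => avg (EulerAlpha.dker k K) f x + avg K g x) = 0 := by
    refine eq_zero_of_integral_mul_eq_zero ((hd.continuous_avg hf).add (hK.continuous_avg hg))
      fun χ hχ => ?_
    have hs' : ContDiff ℝ ∞ fun w => K (-w) := hs.comp contDiff_neg
    have h1 := hfg _ (hK.neg.isSmooth_avg hs' hχ)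
    rw [hK.neg.pderiv_avg hs' hχ k] at h1
    have e : EulerAlpha.dker k (fun w => K (-w)) = fun z => -EulerAlpha.dker k K (-z) := by
      ext z; exact dker_neg_apply hs k z
    have e2 : ∀ x, -avg (EulerAlpha.dker k fun w => K (-w)) χ x
        = avg (fun z => EulerAlpha.dker k K (-z)) χ x := by
      intro x; rw [e]; simp only [avg, ← integral_neg]; congr 1; ext z; ring
    simp only [e2] at h1
    rw [← hd.integral_mul_avg_comm hχ hf, ← hK.integral_mul_avg_comm hχ hg] at h1
    obtain ⟨c, -, hc⟩ := hd.exists_bound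
    obtain ⟨c', -, hc'⟩ := hK.exists_bound
    simp only [mul_add]
    rw [integral_add, h1, neg_add_cancel]
    · exact hχ.mul_bdd (hd.continuous_avg hf).aestronglyMeasurable
        (Eventually.of_forall (hd.abs_avg_le hc hf))
    · exact hχ.mul_bdd (hK.continuous_avg hg).aestronglyMeasurable
        (Eventually.of_forall (hK.abs_avg_le hc' hg))
  ext x
  have := congrFun key x
  simp only [Pi.zero_apply] at this
  linarith

theorem IsKernel.pderiv_avg_of_isWeakPartial (hK : IsKernel L K) (hs : ContDiff ℝ ∞ K)
    (hf : Integrable f volume) (hg : Integrable g volume) {k : Fin n}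
    (hfg : IsWeakPartial k f g) : pderiv k (avg K f) = avg K g := by
  rw [hK.pderiv_avg hs hf, hK.avg_dker hs hf hg hfg]
  simp

theorem IsKernel.sum_avg_dker (hK : IsKernel L K) (hs : ContDiff ℝ ∞ K)
    {v : Torus L n → Vec n} (hv : ∀ i, Integrable (fun x => v x i) volume)
    (hdiv : IsWeaklyDivFree v) (x : Torus L n) :
    ∑ i, avg (EulerAlpha.dker i K) (fun y => v y i) x = 0 := by
  have hd := fun i => hK.dker hs i
  have hc := fun i => (hd i).continuous_avg (hv i)
  have hint : ∀ (χ : Torus L n → ℝ), Integrable χ volume → ∀ i,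
      Integrable (fun x => χ x * avg (EulerAlpha.dker i K) (fun y => v y i) x) volume := by
    intro χ hχ i
    obtain ⟨c, -, hb⟩ := (hd i).exists_bound
    exact hχ.mul_bdd (hc i).aestronglyMeasurable
      (Eventually.of_forall ((hd i).abs_avg_le hb (hv i)))
  have key : (fun x => ∑ i, avg (EulerAlpha.dker i K) (fun y => v y i) x) = 0 := by
    refine eq_zero_of_integral_mul_eq_zero (continuous_finsetSum _ fun i _ => hc i)
      fun χ hχ => ?_
    have hs' : ContDiff ℝ ∞ fun w => K (-w) := hs.comp contDiff_neg
    have h1 := hdiv _ (hK.neg.isSmooth_avg hs' hχ)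
    have e : ∀ i x, pderiv i (avg (fun w => K (-w)) χ) x
        = avg (fun z => EulerAlpha.dker i K (-z)) χ x := by
      intro i x
      rw [hK.neg.pderiv_avg hs' hχ i]
      simp only [avg, ← integral_neg, dker_neg_apply hs]; congr 1; ext z; ring
    simp only [e] at h1
    simp only [Finset.mul_sum]
    rw [integral_finsetSum _ fun i _ => hint χ hχ i, ← h1, integral_finsetSum]
    · exact Finset.sum_congr rfl fun i _ => (hd i).integral_mul_avg_comm hχ (hv i)
    · intro i _
      obtain ⟨c, -, hb⟩ := (hd i).neg.exists_bound
      exact (hv i).mul_bdd ((hd i).neg.continuous_avg hχ).aestronglyMeasurable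
        (Eventually.of_forall ((hd i).neg.abs_avg_le hb hχ))
  exact congrFun key x

end Smoothing

/-! ### Mollifiers and continuity of translations -/

section Mollifiers

variable {L : ℝ} {n : ℕ}

/-- Smooth even probability densities supported in the ball of radius `δ`. The bound `C` on the
first moments of the gradient is scale invariant, hence can be uniform as `δ → 0`. -/
structure IsMollifier (L C δ : ℝ) (ρ : Vec n → ℝ) : Prop where
  isKernel : IsKernel L ρ
  contDiff : ContDiff ℝ ∞ ρ
  even : ∀ z, ρ (-z) = ρ z
  nonneg : ∀ z, 0 ≤ ρ z
  integral_eq_one : ∫ z, ρ z = 1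
  eq_zero : ∀ z, δ ≤ ‖z‖ → ρ z = 0
  moment_le : ∀ k, ∫ z, ‖z‖ * |dker k ρ z| ≤ C

theorem exists_isMollifier (n : ℕ) (L : ℝ) :
    ∃ C, 0 ≤ C ∧ ∀ δ, 0 < δ → δ < L / 2 → ∃ ρ : Vec n → ℝ, IsMollifier L C δ ρ := by
  let φ : ContDiffBump (0 : Vec n) := ⟨1 / 2, 1, by norm_num, by norm_num⟩
  set η : Vec n → ℝ := φ.normed volume with hη
  have hηs : ContDiff ℝ ∞ η := φ.contDiff_normed
  refine ⟨∑ k, ∫ w, ‖w‖ * |dker k η w|,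
    Finset.sum_nonneg fun k _ => integral_nonneg fun w => by positivity, fun δ hδ hδL => ?_⟩
  set c : ℝ := (δ ^ n)⁻¹ with hc
  have hc0 : 0 ≤ c := by positivity
  have hzero : ∀ z : Vec n, δ ≤ ‖z‖ → c * η (δ⁻¹ • z) = 0 := by
    intro z hz
    have : δ⁻¹ • z ∉ Function.support η := by
      rw [hη, φ.support_normed_eq]
      simp only [Metric.mem_ball, dist_zero_right, norm_smul, norm_inv, Real.norm_eq_abs,
        abs_of_pos hδ, not_lt]
      rw [inv_mul_eq_div, le_div_iff₀ hδ]
      simpa [φ] using hz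
    rw [Function.notMem_support.1 this, mul_zero]
  have hs : ContDiff ℝ ∞ fun z : Vec n => c * η (δ⁻¹ • z) :=
    contDiff_const.mul (hηs.comp (contDiff_const_smul _))
  have hd : ∀ k (z : Vec n), dker k (fun z : Vec n => c * η (δ⁻¹ • z)) z
      = c * (δ⁻¹ * dker k η (δ⁻¹ • z)) := by
    intro k z
    have h1 := (hηs.differentiable (by simp)).differentiableAt (x := δ⁻¹ • z)
    have h2 := ((h1.hasFDerivAt.comp z ((hasFDerivAt_id z).const_smul δ⁻¹)).const_mul c).fderiv
    have h3 : fderiv ℝ (fun z : Vec n => c * η (δ⁻¹ • z)) z = _ := h2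
    simp [dker, h3]
  have hfin : Module.finrank ℝ (Vec n) = n := by simp
  refine ⟨fun z => c * η (δ⁻¹ • z), ⟨⟨hs.continuous, δ, hδL, hzero⟩, hs, fun z => ?_,
    fun z => mul_nonneg hc0 (φ.nonneg_normed _), ?_, hzero, fun k => ?_⟩⟩
  · rw [smul_neg, hη, φ.normed_neg]
  · rw [integral_const_mul, Measure.integral_comp_inv_smul_of_nonneg _ _ hδ.le, hfin,
      φ.integral_normed, hc, smul_eq_mul, mul_one, inv_mul_cancel₀ (by positivity)]
  · have e : ∀ z : Vec n, ‖z‖ * |dker k (fun z : Vec n => c * η (δ⁻¹ • z)) z|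
        = c * (‖δ⁻¹ • z‖ * |dker k η (δ⁻¹ • z)|) := by
      intro z
      rw [hd, abs_mul, abs_mul, abs_of_nonneg hc0, norm_smul, Real.norm_eq_abs]
      ring
    simp only [e]
    rw [integral_const_mul,
      Measure.integral_comp_inv_smul_of_nonneg volume (fun w => ‖w‖ * |dker k η w|) hδ.le, hfin,
      hc, smul_eq_mul, inv_mul_cancel_left₀ (by positivity)]
    exact Finset.single_le_sum (f := fun k => ∫ w, ‖w‖ * |dker k η w|)
      (fun k _ => integral_nonneg fun w => by positivity) (Finset.mem_univ k)

variable {C δ : ℝ} {ρ : Vec n → ℝ}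

theorem IsMollifier.isKernel_dker (hρ : IsMollifier L C δ ρ) (k : Fin n) :
    IsKernel L (dker k ρ) :=
  hρ.isKernel.dker hρ.contDiff k

theorem IsMollifier.dker_eq_zero (hρ : IsMollifier L C δ ρ) (k : Fin n) {z : Vec n}
    (hz : δ < ‖z‖) : dker k ρ z = 0 := by
  have h1 : ρ =ᶠ[𝓝 z] fun _ => 0 := by
    filter_upwards [(isOpen_lt continuous_const continuous_norm).mem_nhds hz] with w hw
      using hρ.eq_zero w (le_of_lt hw)
  simp [dker, h1.fderiv_eq]

theorem IsMollifier.integral_dker (hρ : IsMollifier L C δ ρ) (k : Fin n) :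
    ∫ z, dker k ρ z = 0 := by
  have h := integral_neg_eq_self (fun z => dker k ρ z) volume
  simp only [dker_odd hρ.contDiff hρ.even, integral_neg] at h
  linarith

theorem IsMollifier.abs_integral_mul_sub_le (hρ : IsMollifier L C δ ρ) {Φ : Vec n → ℝ} {a κ : ℝ}
    (hΦ : Integrable (fun z => ρ z * Φ z) volume) (h : ∀ z, ‖z‖ ≤ δ → |Φ z - a| ≤ κ) :
    |(∫ z, ρ z * Φ z) - a| ≤ κ := by
  have e : (∫ z, ρ z * Φ z) - a = ∫ z, ρ z * (Φ z - a) := by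
    simp only [mul_sub]
    rw [integral_sub hΦ (hρ.isKernel.integrable.mul_const a), integral_mul_const,
      hρ.integral_eq_one, one_mul]
  have e2 : κ = ∫ z, ρ z * κ := by rw [integral_mul_const, hρ.integral_eq_one, one_mul]
  rw [e, e2, ← Real.norm_eq_abs]
  refine norm_integral_le_of_norm_le (hρ.isKernel.integrable.mul_const κ)
    (Eventually.of_forall fun z => ?_)
  rw [norm_mul, Real.norm_eq_abs, Real.norm_eq_abs, abs_of_nonneg (hρ.nonneg z)]
  rcases le_or_gt ‖z‖ δ with hz | hz
  · exact mul_le_mul_of_nonneg_left (h z hz) (hρ.nonneg z)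
  · simp [hρ.eq_zero z hz.le]

theorem IsMollifier.abs_integral_dker_mul_le (hρ : IsMollifier L C δ ρ) (k : Fin n)
    {Φ : Vec n → ℝ} {κ : ℝ} (hκ : 0 ≤ κ) (h : ∀ z, ‖z‖ ≤ δ → |Φ z| ≤ κ * ‖z‖) :
    |∫ z, dker k ρ z * Φ z| ≤ C * κ := by
  have hint : Integrable (fun z => ‖z‖ * |dker k ρ z|) volume := by
    refine Continuous.integrable_of_hasCompactSupport
      (continuous_norm.mul (hρ.isKernel_dker k).continuous.abs) ?_
    exact (hρ.isKernel_dker k).hasCompactSupport.norm.mul_left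
  rw [← Real.norm_eq_abs]
  refine le_trans (norm_integral_le_of_norm_le (hint.mul_const κ)
    (Eventually.of_forall fun z => ?_)) ?_
  · rw [norm_mul, Real.norm_eq_abs, Real.norm_eq_abs]
    rcases le_or_gt ‖z‖ δ with hz | hz
    · calc |dker k ρ z| * |Φ z| ≤ |dker k ρ z| * (κ * ‖z‖) :=
            mul_le_mul_of_nonneg_left (h z hz) (abs_nonneg _)
        _ = ‖z‖ * |dker k ρ z| * κ := by ring
    · simp [hρ.dker_eq_zero k hz]
  · rw [integral_mul_const]
    exact mul_le_mul_of_nonneg_right (hρ.moment_le k) hκ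

variable [Fact (0 < L)]

theorem tendsto_eLpNorm_translate_sub {E : Type*} [NormedAddCommGroup E] {p : ℝ≥0∞}
    [Fact (1 ≤ p)] [Fact (p ≠ ⊤)] {f : Torus L n → E} (hf : MemLp f p volume) :
    Tendsto (fun z : Vec n => eLpNorm (fun x => f (x + proj L z) - f x) p volume)
      (𝓝 0) (𝓝 0) := by
  have h1 : Tendsto (fun z : Vec n => edist
      ((DomAddAct.mk (proj L z) : (Torus L n)ᵈᵃᵃ) +ᵥ hf.toLp f) (hf.toLp f)) (𝓝 0) (𝓝 0) := by
    have hc : Continuous fun z : Vec n => edist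
        ((DomAddAct.mk (proj L z) : (Torus L n)ᵈᵃᵃ) +ᵥ hf.toLp f) (hf.toLp f) := by
      have h0 : Continuous fun z : Vec n => (DomAddAct.mk (proj L z) : (Torus L n)ᵈᵃᵃ) :=
        DomAddAct.continuous_mk.comp continuous_proj
      have h2 : Continuous fun z : Vec n =>
          (DomAddAct.mk (proj L z) : (Torus L n)ᵈᵃᵃ) +ᵥ hf.toLp f :=
        (@continuous_vadd _ _ _ _ _ Lp.instContinuousVAddDomAddAct).comp
          (h0.prodMk continuous_const)
      exact Continuous.edist h2 continuous_const
    have := hc.tendsto 0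
    simpa [proj_zero] using this
  refine h1.congr fun z => ?_
  rw [DomAddAct.mk_vadd_toLp, Lp.edist_toLp_toLp]
  congr 1
  ext x
  simp [add_comm]

end Mollifiers

/-! ### Differences and a Marchaud inequality -/

section Marchaud

/-- One step of the descent in the order of the difference: above the critical order the exponent
`σ` is kept, by iterating the dyadic recursion. -/
theorem marchaud_step {E : Type*} [NormedAddCommGroup E] [NormedSpace ℝ E] {σ : ℝ} (h0 : 0 < σ)
    (h2 : σ < 2) (r : ℕ) (hr : 2 ≤ r) : ∃ C : ℝ, 0 ≤ C ∧ ∀ (N N' : E → ℝ) (A : ℝ), 0 ≤ A →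
      (∀ h, N h ≤ 2 ^ r * A) → (∀ h, 2 ^ r * N h ≤ N ((2 : ℝ) • h) + r * 2 ^ (r - 1) * N' h) →
      (∀ h, h ≠ 0 → ‖h‖ ≤ 1 → N' h ≤ A * ‖h‖ ^ σ) →
      ∀ h, h ≠ 0 → ‖h‖ ≤ 1 → N h ≤ C * A * ‖h‖ ^ σ := by
  set q : ℝ := 2 ^ (σ - 2) with hq
  have hq1 : q < 1 := Real.rpow_lt_one_of_one_lt_of_neg one_lt_two (by linarith)
  have hq0 : 0 < q := by positivity
  set C : ℝ := 2 ^ r * 2 ^ σ + r / 2 / (1 - q) with hC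
  have h1q : 0 < 1 - q := by linarith
  have hC1 : (2 : ℝ) ^ r * 2 ^ σ ≤ C := le_add_of_nonneg_right (by positivity)
  have hC2 : q * C + r / 2 ≤ C := by
    have : r / 2 / (1 - q) ≤ C := le_add_of_nonneg_left (by positivity)
    rw [div_le_iff₀ h1q] at this
    linarith
  refine ⟨C, by positivity, fun N N' A hA hN hrec hN' => ?_⟩
  have key : ∀ j : ℕ, ∀ h : E, (1 / 2 : ℝ) ^ j ≤ ‖h‖ → ‖h‖ ≤ 1 → N h ≤ C * A * ‖h‖ ^ σ := by
    intro j
    induction j with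
    | zero =>
      intro h hj h1
      have e : ‖h‖ = 1 := le_antisymm h1 (by simpa using hj)
      have h1σ : (1 : ℝ) ≤ 2 ^ σ := Real.one_le_rpow one_le_two h0.le
      rw [e, Real.one_rpow, mul_one]
      refine (hN h).trans (mul_le_mul_of_nonneg_right (le_trans ?_ hC1) hA)
      exact le_mul_of_one_le_right (by positivity) h1σ
    | succ j ih =>
      intro h hj h1
      have hpos : 0 < ‖h‖ := lt_of_lt_of_le (by positivity) hj
      have hne : h ≠ 0 := norm_pos_iff.1 hpos
      have hσ : 0 ≤ ‖h‖ ^ σ := by positivity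
      rcases le_or_gt ‖h‖ (1 / 2) with hh | hh
      · have hn : ‖(2 : ℝ) • h‖ = 2 * ‖h‖ := by rw [norm_smul]; simp
        have hi := ih ((2 : ℝ) • h) (by rw [hn]; rw [pow_succ] at hj; linarith)
          (by rw [hn]; linarith)
        rw [hn, Real.mul_rpow (by norm_num) hpos.le] at hi
        have hb := hrec h
        have hc := mul_le_mul_of_nonneg_left (hN' h hne h1)
          (show (0 : ℝ) ≤ r * 2 ^ (r - 1) by positivity)
        have e1 : (2 : ℝ) ^ σ = 4 * q := by
          rw [hq, Real.rpow_sub two_pos]; norm_num; ring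
        have e2 : (2 : ℝ) ^ r = 2 * 2 ^ (r - 1) := by
          rw [← pow_succ']; congr 1; omega
        have e3 : (4 : ℝ) ≤ 2 ^ r := by
          calc (4 : ℝ) = 2 ^ 2 := by norm_num
            _ ≤ 2 ^ r := pow_le_pow_right₀ one_le_two hr
        have hCA : 0 ≤ C * A * ‖h‖ ^ σ := by positivity
        have h4 : C * A * (2 ^ σ * ‖h‖ ^ σ) ≤ 2 ^ r * (q * (C * A * ‖h‖ ^ σ)) := by
          rw [e1]
          have := mul_le_mul_of_nonneg_right e3 (show 0 ≤ q * (C * A * ‖h‖ ^ σ) by positivity)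
          linarith
        have h5 : (2 : ℝ) ^ r * N h ≤ 2 ^ r * (C * A * ‖h‖ ^ σ) := by
          calc (2 : ℝ) ^ r * N h ≤ 2 ^ r * (q * (C * A * ‖h‖ ^ σ))
                + r * 2 ^ (r - 1) * (A * ‖h‖ ^ σ) := by linarith
            _ = 2 ^ r * ((q * C + r / 2) * (A * ‖h‖ ^ σ)) := by rw [e2]; ring
            _ ≤ 2 ^ r * (C * (A * ‖h‖ ^ σ)) := by gcongr
            _ = _ := by ring
        exact le_of_mul_le_mul_left h5 (by positivity)
      · have h3 : (1 / 2 : ℝ) ^ σ ≤ ‖h‖ ^ σ := Real.rpow_le_rpow (by norm_num) hh.le h0.le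
        have h4 : (2 : ℝ) ^ σ * (1 / 2 : ℝ) ^ σ = 1 := by
          rw [← Real.mul_rpow (by norm_num) (by norm_num)]; norm_num
        calc N h ≤ 2 ^ r * A := hN h
          _ = 2 ^ r * 2 ^ σ * A * (1 / 2 : ℝ) ^ σ := by
            rw [show (2 : ℝ) ^ r * 2 ^ σ * A * (1 / 2 : ℝ) ^ σ
              = 2 ^ r * A * (2 ^ σ * (1 / 2 : ℝ) ^ σ) by ring, h4, mul_one]
          _ ≤ C * A * ‖h‖ ^ σ := by gcongr
  intro h hne h1
  obtain ⟨j, hj⟩ := exists_pow_lt_of_lt_one (norm_pos_iff.2 hne) (show (1 / 2 : ℝ) < 1 by norm_num)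
  exact key j h hj.le h1

/-- The last step of the descent, from second to first differences. As `σ > 1` the dyadic sum
converges; the term `D ‖h‖ ^ (σ - 1)` keeps track of its tail. -/
theorem marchaud_last {E : Type*} [NormedAddCommGroup E] [NormedSpace ℝ E] {σ : ℝ} (h1 : 1 < σ) :
    ∃ C : ℝ, 0 ≤ C ∧ ∀ (N N' : E → ℝ) (A : ℝ), 0 ≤ A →
      (∀ h, N h ≤ 2 * A) → (∀ h, 2 * N h ≤ N ((2 : ℝ) • h) + N' h) →
      (∀ h, h ≠ 0 → ‖h‖ ≤ 1 → N' h ≤ A * ‖h‖ ^ σ) →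
      ∀ h, h ≠ 0 → ‖h‖ ≤ 1 → N h ≤ C * A * ‖h‖ := by
  have hp : (1 : ℝ) < 2 ^ (σ - 1) := Real.one_lt_rpow one_lt_two (by linarith)
  set D : ℝ := 1 / (2 * (2 ^ (σ - 1) - 1)) with hD
  have hD0 : 0 ≤ D := by
    have : 0 < (2 : ℝ) ^ (σ - 1) - 1 := by linarith
    positivity
  have hD1 : D * 2 ^ (σ - 1) = D + 1 / 2 := by
    have : (2 : ℝ) ^ (σ - 1) - 1 ≠ 0 := by linarith
    rw [hD]; field_simp; ring
  refine ⟨D + 4, by positivity, fun N N' A hA hN hrec hN' => ?_⟩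
  have big : ∀ h : E, 1 / 2 < ‖h‖ → ‖h‖ ≤ 1 →
      N h ≤ (D + 4 - D * ‖h‖ ^ (σ - 1)) * A * ‖h‖ := by
    intro h hh h1'
    have : ‖h‖ ^ (σ - 1) ≤ 1 := Real.rpow_le_one (norm_nonneg _) h1' (by linarith)
    have h3 : 4 ≤ D + 4 - D * ‖h‖ ^ (σ - 1) := by
      have := mul_le_mul_of_nonneg_left this hD0
      linarith
    calc N h ≤ 4 * A * (1 / 2) := by linarith [hN h]
      _ ≤ (D + 4 - D * ‖h‖ ^ (σ - 1)) * A * ‖h‖ := by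
        have : 0 ≤ D + 4 - D * ‖h‖ ^ (σ - 1) := by linarith
        gcongr
  have key : ∀ j : ℕ, ∀ h : E, (1 / 2 : ℝ) ^ j ≤ ‖h‖ → ‖h‖ ≤ 1 →
      N h ≤ (D + 4 - D * ‖h‖ ^ (σ - 1)) * A * ‖h‖ := by
    intro j
    induction j with
    | zero => exact fun h hj h1' => big h (by rw [pow_zero] at hj; linarith) h1'
    | succ j ih =>
      intro h hj h1'
      have hpos : 0 < ‖h‖ := lt_of_lt_of_le (by positivity) hj
      have hne : h ≠ 0 := norm_pos_iff.1 hpos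
      rcases le_or_gt ‖h‖ (1 / 2) with hh | hh
      · have hn : ‖(2 : ℝ) • h‖ = 2 * ‖h‖ := by rw [norm_smul]; simp
        have hi := ih ((2 : ℝ) • h) (by rw [hn]; rw [pow_succ] at hj; linarith)
          (by rw [hn]; linarith)
        rw [hn, Real.mul_rpow (by norm_num) hpos.le, ← mul_assoc D, hD1] at hi
        have hb := hrec h
        have hc := hN' h hne h1'
        have e : ‖h‖ ^ σ = ‖h‖ ^ (σ - 1) * ‖h‖ := by
          rw [← Real.rpow_add_one hpos.ne']; congr 1; ring
        rw [e] at hc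
        linarith
      · exact big h hh h1'
  intro h hne h1'
  obtain ⟨j, hj⟩ := exists_pow_lt_of_lt_one (norm_pos_iff.2 hne) (show (1 / 2 : ℝ) < 1 by norm_num)
  refine (key j h hj.le h1').trans ?_
  have : 0 ≤ D * ‖h‖ ^ (σ - 1) := by positivity
  gcongr
  linarith

theorem marchaud {E : Type*} [NormedAddCommGroup E] [NormedSpace ℝ E] {σ : ℝ} (h1 : 1 < σ)
    (h2 : σ < 2) (m : ℕ) (hm : 2 ≤ m) : ∃ C : ℝ, 0 ≤ C ∧ ∀ (N : ℕ → E → ℝ) (A : ℝ), 0 ≤ A →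
      (∀ r h, N r h ≤ 2 ^ r * A) →
      (∀ r h, 2 ^ r * N r h ≤ N r ((2 : ℝ) • h) + r * 2 ^ (r - 1) * N (r + 1) h) →
      (∀ h, h ≠ 0 → ‖h‖ ≤ 1 → N m h ≤ A * ‖h‖ ^ σ) →
      ∀ h, h ≠ 0 → ‖h‖ ≤ 1 → N 1 h ≤ C * A * ‖h‖ := by
  induction m, hm using Nat.le_induction with
  | base =>
    obtain ⟨C, hC, H⟩ := marchaud_last (E := E) h1
    refine ⟨C, hC, fun N A hA hN hrec hm => H (N 1) (N 2) A hA (fun h => ?_) (fun h => ?_) hm⟩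
    · simpa using hN 1 h
    · simpa using hrec 1 h
  | succ m hm ih =>
    obtain ⟨C, hC, H⟩ := ih
    obtain ⟨C', hC', H'⟩ := marchaud_step (E := E) (by linarith) h2 m hm
    refine ⟨C * (C' + 1), by positivity, fun N A hA hN hrec hm1 h hne hh => ?_⟩
    have h3 := H' (N m) (N (m + 1)) A hA (hN m) (hrec m) hm1
    have hA' : A ≤ (C' + 1) * A := by nlinarith
    have h4 := H N ((C' + 1) * A) (by positivity)
      (fun r h => (hN r h).trans (mul_le_mul_of_nonneg_left hA' (by positivity))) hrec
      (fun h hne hh => (h3 h hne hh).trans (mul_le_mul_of_nonneg_right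
        (by linarith) (by positivity))) h hne hh
    rwa [← mul_assoc] at h4

variable {L : ℝ} {n : ℕ} {E : Type*} [NormedAddCommGroup E] {p : ℝ≥0∞}

/-- The sum of a function and its translate. -/
def fwdSum (a : Torus L n) (f : Torus L n → E) (x : Torus L n) : E := f (x + a) + f x

theorem commute_fwdSum_fwdDiff (a : Torus L n) :
    Function.Commute (fwdSum a : (Torus L n → E) → _) (fwdDiff a) := by
  intro f
  ext x
  simp only [fwdSum, fwdDiff]
  abel

theorem fwdDiff_add_self (a : Torus L n) :
    (fwdDiff (a + a) : (Torus L n → E) → _) = fwdSum a ∘ fwdDiff a := by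
  ext f x
  simp only [fwdSum, fwdDiff, Function.comp_apply, add_assoc]
  abel

variable [Fact (0 < L)]

/-- The `L^p` norm on the torus as a real number. -/
def nrm (p : ℝ≥0∞) (f : Torus L n → E) : ℝ := (eLpNorm f p volume).toReal

theorem nrm_nonneg (p : ℝ≥0∞) (f : Torus L n → E) : 0 ≤ nrm p f := ENNReal.toReal_nonneg

theorem nrm_add_le (hp : 1 ≤ p) {f g : Torus L n → E} (hf : MemLp f p volume)
    (hg : MemLp g p volume) : nrm p (fun x => f x + g x) ≤ nrm p f + nrm p g := by
  rw [nrm, nrm, nrm, ← ENNReal.toReal_add hf.eLpNorm_ne_top hg.eLpNorm_ne_top]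
  exact ENNReal.toReal_mono (ENNReal.add_ne_top.2 ⟨hf.eLpNorm_ne_top, hg.eLpNorm_ne_top⟩)
    (eLpNorm_add_le hf.1 hg.1 hp)

theorem nrm_neg (p : ℝ≥0∞) (f : Torus L n → E) : nrm p (fun x => -f x) = nrm p f :=
  congrArg ENNReal.toReal (eLpNorm_neg f p volume)

theorem nrm_sub_le (hp : 1 ≤ p) {f g : Torus L n → E} (hf : MemLp f p volume)
    (hg : MemLp g p volume) : nrm p (fun x => f x - g x) ≤ nrm p f + nrm p g := by
  have := nrm_add_le hp hf hg.neg
  simp only [Pi.neg_apply, ← sub_eq_add_neg] at this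
  rw [← nrm_neg p g]
  exact this

theorem nrm_translate {f : Torus L n → E} (hf : AEStronglyMeasurable f volume) (a : Torus L n) :
    nrm p (fun x => f (x + a)) = nrm p f :=
  congrArg ENNReal.toReal (eLpNorm_translate hf p a)

theorem memLp_fwdDiff {f : Torus L n → E} (hf : MemLp f p volume) (a : Torus L n) :
    MemLp (fwdDiff a f) p volume := (memLp_translate hf a).sub hf

theorem memLp_fwdDiff_iterate {f : Torus L n → E} (hf : MemLp f p volume) (a : Torus L n)
    (r : ℕ) : MemLp ((fwdDiff a)^[r] f) p volume := by
  induction r with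
  | zero => exact hf
  | succ r ih => rw [Function.iterate_succ_apply']; exact memLp_fwdDiff ih a

theorem memLp_fwdSum_iterate {f : Torus L n → E} (hf : MemLp f p volume) (a : Torus L n)
    (r : ℕ) : MemLp ((fwdSum a)^[r] f) p volume := by
  induction r with
  | zero => exact hf
  | succ r ih => rw [Function.iterate_succ_apply']; exact (memLp_translate ih a).add ih

theorem nrm_fwdDiff_iterate_le (hp : 1 ≤ p) {f : Torus L n → E} (hf : MemLp f p volume)
    (a : Torus L n) (r : ℕ) : nrm p ((fwdDiff a)^[r] f) ≤ 2 ^ r * nrm p f := by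
  induction r with
  | zero => simp
  | succ r ih =>
    rw [Function.iterate_succ_apply']
    have h := memLp_fwdDiff_iterate hf a r
    have h2 := nrm_sub_le hp (memLp_translate h a) h
    rw [nrm_translate h.1] at h2
    refine h2.trans ?_
    rw [pow_succ]; linarith

theorem nrm_fwdSum_iterate_le (hp : 1 ≤ p) {f : Torus L n → E} (hf : MemLp f p volume)
    (a : Torus L n) (r : ℕ) : nrm p ((fwdSum a)^[r] f) ≤ 2 ^ r * nrm p f := by
  induction r with
  | zero => simp
  | succ r ih =>
    rw [Function.iterate_succ_apply']
    have h := memLp_fwdSum_iterate hf a r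
    have h2 := nrm_add_le hp (memLp_translate h a) h
    rw [nrm_translate h.1] at h2
    refine h2.trans ?_
    rw [pow_succ]; linarith

variable [NormedSpace ℝ E]

theorem nrm_two_pow_sub_fwdSum_le (hp : 1 ≤ p) {f : Torus L n → E} (hf : MemLp f p volume)
    (a : Torus L n) (r : ℕ) : nrm p (fun x => (2 : ℝ) ^ r • f x - (fwdSum a)^[r] f x)
      ≤ r * 2 ^ (r - 1) * nrm p (fwdDiff a f) := by
  induction r with
  | zero => simp [nrm]
  | succ r ih =>
    have h := memLp_fwdSum_iterate hf a r
    have hd := memLp_fwdSum_iterate (memLp_fwdDiff hf a) a r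
    have hg : MemLp (fun x => (2 : ℝ) ^ r • f x - (fwdSum a)^[r] f x) p volume :=
      (hf.const_smul ((2 : ℝ) ^ r)).sub h
    have hc : ∀ x, (fwdSum a)^[r] (fwdDiff a f) x
        = (fwdSum a)^[r] f (x + a) - (fwdSum a)^[r] f x := fun x =>
      congrFun ((commute_fwdSum_fwdDiff (E := E) a).iterate_left r f) x
    have e : (fun x => (2 : ℝ) ^ (r + 1) • f x - (fwdSum a)^[r + 1] f x) = fun x =>
        (((2 : ℝ) ^ r • f x - (fwdSum a)^[r] f x) + ((2 : ℝ) ^ r • f x - (fwdSum a)^[r] f x))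
          - (fwdSum a)^[r] (fwdDiff a f) x := by
      ext x
      rw [Function.iterate_succ_apply', hc, pow_succ, mul_two, add_smul, fwdSum]
      abel
    rw [e]
    have h1 := nrm_sub_le hp (hg.add hg) hd
    have h2 := nrm_add_le hp hg hg
    have h3 := nrm_fwdSum_iterate_le hp (memLp_fwdDiff hf a) a r
    have e2 : ((r + 1 : ℕ) : ℝ) * 2 ^ (r + 1 - 1) = 2 * (r * 2 ^ (r - 1)) + 2 ^ r := by
      rcases r with _ | r
      · simp
      · simp only [Nat.add_sub_cancel, pow_succ]; push_cast; ring
    rw [e2]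
    have h4 : nrm p (fun x => (((2 : ℝ) ^ r • f x - (fwdSum a)^[r] f x)
        + ((2 : ℝ) ^ r • f x - (fwdSum a)^[r] f x)) - (fwdSum a)^[r] (fwdDiff a f) x) ≤ _ := h1
    refine h4.trans ?_
    have h5 : nrm p ((fun x => (2 : ℝ) ^ r • f x - (fwdSum a)^[r] f x)
      + fun x => (2 : ℝ) ^ r • f x - (fwdSum a)^[r] f x) ≤ _ := h2
    linarith

/-- The identity `Δ_{2h}^r = (Δ_h + 2)^r Δ_h^r`, in the form of an inequality. -/
theorem nrm_fwdDiff_double_le (hp : 1 ≤ p) {f : Torus L n → E} (hf : MemLp f p volume)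
    (a : Torus L n) (r : ℕ) : 2 ^ r * nrm p ((fwdDiff a)^[r] f)
      ≤ nrm p ((fwdDiff (a + a))^[r] f) + r * 2 ^ (r - 1) * nrm p ((fwdDiff a)^[r + 1] f) := by
  have hd := memLp_fwdDiff_iterate hf a r
  have e : (fwdDiff (a + a))^[r] f = (fwdSum a)^[r] ((fwdDiff a)^[r] f) := by
    rw [fwdDiff_add_self, (commute_fwdSum_fwdDiff a).comp_iterate]; rfl
  have h1 := nrm_two_pow_sub_fwdSum_le hp hd a r
  rw [e, Function.iterate_succ_apply']
  have hs := memLp_fwdSum_iterate hd a r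
  have h2 := nrm_add_le hp hs ((hd.const_smul ((2 : ℝ) ^ r)).sub hs)
  have e2 : nrm p (fun x => (fwdSum a)^[r] ((fwdDiff a)^[r] f) x
      + ((fun x => (2 : ℝ) ^ r • (fwdDiff a)^[r] f x) - (fwdSum a)^[r] ((fwdDiff a)^[r] f)) x)
      = 2 ^ r * nrm p ((fwdDiff a)^[r] f) := by
    simp only [Pi.sub_apply, add_sub_cancel]
    rw [nrm, nrm]
    have := eLpNorm_const_smul ((2 : ℝ) ^ r) ((fwdDiff a)^[r] f) p (volume : Measure (Torus L n))
    have e3 : (fun x => (2 : ℝ) ^ r • (fwdDiff a)^[r] f x) = (2 : ℝ) ^ r • (fwdDiff a)^[r] f := rfl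
    rw [e3, this, ENNReal.toReal_mul]
    simp
  have h3 : 2 ^ r * nrm p ((fwdDiff a)^[r] f) ≤ _ := e2 ▸ h2
  exact h3.trans (add_le_add le_rfl h1)

/-- The Besov space of order `s > 1` consists of functions that are Lipschitz in the mean. -/
theorem exists_lipschitz_besov (L : ℝ) [Fact (0 < L)] (n : ℕ) {s : ℝ} (hs : 1 < s) :
    ∃ C : ℝ, 0 ≤ C ∧ ∀ f : Torus L n → Vec n, AEStronglyMeasurable f volume →
      besovNorm s 3 f ≠ ⊤ → ∀ h : Vec n, ‖h‖ ≤ 1 →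
      nrm 3 (fun x => f (x + proj L h) - f x) ≤ C * (besovNorm s 3 f).toReal * ‖h‖ := by
  have hσ1 : 1 < min s (3 / 2) := lt_min hs (by norm_num)
  have hσ2 : min s (3 / 2) < 2 := (min_le_right _ _).trans_lt (by norm_num)
  have hm : 2 ≤ ⌊s⌋₊ + 1 := by
    have : 1 ≤ ⌊s⌋₊ := (Nat.one_le_floor_iff s).2 hs.le
    omega
  obtain ⟨C, hC, H⟩ := marchaud (E := Vec n) hσ1 hσ2 _ hm
  refine ⟨C, hC, fun f hf hb h hh => ?_⟩
  have h13 : (1 : ℝ≥0∞) ≤ 3 := by norm_num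
  have hfb : eLpNorm f 3 volume ≤ besovNorm s 3 f := le_self_add
  have hmem : MemLp f 3 volume := ⟨hf, hfb.trans_lt hb.lt_top⟩
  rcases eq_or_ne h 0 with rfl | hne
  · simp [proj_zero, nrm]
  have hA : nrm 3 f ≤ (besovNorm s 3 f).toReal := ENNReal.toReal_mono hb hfb
  refine H (fun r h => nrm 3 ((fwdDiff (proj L h))^[r] f)) (besovNorm s 3 f).toReal
    ENNReal.toReal_nonneg (fun r h => ?_) (fun r h => ?_) (fun h hne h1 => ?_) h hne hh
  · exact (nrm_fwdDiff_iterate_le h13 hmem _ r).trans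
      (mul_le_mul_of_nonneg_left hA (by positivity))
  · have := nrm_fwdDiff_double_le h13 hmem (proj L h) r
    rwa [← proj_add, ← two_smul ℝ h] at this
  · have h3 : eLpNorm ((fwdDiff (proj L h))^[⌊s⌋₊ + 1] f) 3 volume / ENNReal.ofReal (‖h‖ ^ s)
        ≤ besovNorm s 3 f :=
      (le_iSup₂ (f := fun (h : Vec n) (_ : h ≠ 0) =>
        eLpNorm ((fwdDiff (proj L h))^[⌊s⌋₊ + 1] f) 3 volume / ENNReal.ofReal (‖h‖ ^ s))
        h hne).trans le_add_self
    have hpos : 0 < ‖h‖ := norm_pos_iff.2 hne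
    have h4 := ENNReal.toReal_mono hb h3
    rw [ENNReal.toReal_div, ENNReal.toReal_ofReal (by positivity),
      div_le_iff₀ (by positivity)] at h4
    refine h4.trans (mul_le_mul_of_nonneg_left ?_ ENNReal.toReal_nonneg)
    exact Real.rpow_le_rpow_of_exponent_ge hpos h1 (min_le_left _ _)

end Marchaud

/-! ### Hölder's inequality and convergence of averages -/

section Holder

variable {L : ℝ} {n : ℕ} [Fact (0 < L)] {p q r : ℝ≥0∞} {f g h : Torus L n → ℝ}

instance holderConjugate_three_halves : ENNReal.HolderConjugate (3 / 2) 3 where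
  inv_add_inv_eq_inv := by
    rw [ENNReal.inv_div (by simp) (by simp), inv_one, ← one_div, ENNReal.div_add_div_same,
      show (2 : ℝ≥0∞) + 1 = 3 by norm_num, ENNReal.div_self (by simp) (by simp)]

instance holderTriple_three : ENNReal.HolderTriple 3 3 (3 / 2) where
  inv_add_inv_eq_inv := by
    rw [ENNReal.inv_div (by simp) (by simp), ← one_div, ENNReal.div_add_div_same]
    norm_num

instance fact_one_le_three : Fact ((1 : ℝ≥0∞) ≤ 3) := ⟨by norm_num⟩

instance fact_three_ne_top : Fact ((3 : ℝ≥0∞) ≠ ⊤) := ⟨by simp⟩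

instance fact_two_ne_top : Fact ((2 : ℝ≥0∞) ≠ ⊤) := ⟨by simp⟩

theorem memLp_mul [ENNReal.HolderTriple p q r] (hf : MemLp f p volume) (hg : MemLp g q volume) :
    MemLp (fun x => f x * g x) r volume := hg.mul' hf

theorem nrm_mul_le [ENNReal.HolderTriple p q r] (hf : MemLp f p volume) (hg : MemLp g q volume) :
    nrm r (fun x => f x * g x) ≤ nrm p f * nrm q g := by
  rw [nrm, nrm, nrm, ← ENNReal.toReal_mul]
  exact ENNReal.toReal_mono (ENNReal.mul_ne_top hf.eLpNorm_ne_top hg.eLpNorm_ne_top)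
    (eLpNorm_smul_le_mul_eLpNorm (φ := f) (f := g) hg.1 hf.1)

theorem abs_integral_le_nrm (hf : Integrable f volume) : |∫ x, f x| ≤ nrm 1 f := by
  rw [nrm, eLpNorm_one_eq_lintegral_enorm]
  refine (abs_integral_le_integral_abs).trans (le_of_eq ?_)
  exact integral_norm_eq_lintegral_enorm hf.1

theorem integrable_mul_of_memLp [ENNReal.HolderConjugate p q] (hf : MemLp f p volume)
    (hg : MemLp g q volume) : Integrable (fun x => f x * g x) volume :=
  memLp_one_iff_integrable.1 (memLp_mul hf hg)

theorem abs_integral_mul_le [ENNReal.HolderConjugate p q] (hf : MemLp f p volume)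
    (hg : MemLp g q volume) : |∫ x, f x * g x| ≤ nrm p f * nrm q g :=
  (abs_integral_le_nrm (integrable_mul_of_memLp hf hg)).trans (nrm_mul_le hf hg)

theorem exists_nrm_translate_sub_le [Fact (1 ≤ p)] [Fact (p ≠ ⊤)] (hf : MemLp f p volume)
    {ε : ℝ} (hε : 0 < ε) :
    ∃ δ > 0, ∀ z : Vec n, ‖z‖ < δ → nrm p (fun x => f (x + proj L z) - f x) ≤ ε := by
  have h := (ENNReal.tendsto_nhds_zero.1 (tendsto_eLpNorm_translate_sub hf))
    (ENNReal.ofReal ε) (by simpa using hε)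
  obtain ⟨δ, hδ, H⟩ := Metric.eventually_nhds_iff.1 h
  refine ⟨δ, hδ, fun z hz => ?_⟩
  have := ENNReal.toReal_mono ENNReal.ofReal_ne_top (H (by simpa using hz))
  rwa [ENNReal.toReal_ofReal hε.le] at this

variable {C : ℝ} {δ : ℕ → ℝ} {ρ : ℕ → Vec n → ℝ}

/-- Averages with mollifiers of shrinking support are an approximation of the identity, weakly;
only the continuity of translations in `L^q` enters. -/
theorem tendsto_integral_mul_avg [ENNReal.HolderConjugate p q] [Fact (1 ≤ q)] [Fact (q ≠ ⊤)]
    (hρ : ∀ j, IsMollifier L C (δ j) (ρ j)) (hδ : Tendsto δ atTop (𝓝 0))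
    (hf : MemLp f p volume) (hg : MemLp g q volume) :
    Tendsto (fun j => ∫ x, f x * avg (ρ j) g x) atTop (𝓝 (∫ x, f x * g x)) := by
  have hp : 1 ≤ p := ENNReal.HolderTriple.le p q 1
  have hfi : Integrable f volume := hf.integrable hp
  have hgi : Integrable g volume := hg.integrable Fact.out
  rw [Metric.tendsto_atTop]
  intro ε hε
  obtain ⟨η, hη, hη'⟩ := exists_nrm_translate_sub_le hg
    (show 0 < ε / (2 * (nrm p f + 1)) by have := nrm_nonneg p f; positivity)
  obtain ⟨J, hJ⟩ := eventually_atTop.1 (hδ.eventually (gt_mem_nhds hη))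
  refine ⟨J, fun j hj => ?_⟩
  rw [(hρ j).isKernel.integral_mul_avg hfi hgi, Real.dist_eq]
  refine lt_of_le_of_lt ((hρ j).abs_integral_mul_sub_le (κ := ε / 2)
    ((hρ j).isKernel.integrable_corr hfi hgi) fun z hz => ?_) (by linarith)
  have ht : MemLp (fun x => g (x + proj L z) - g x) q volume := (memLp_translate hg _).sub hg
  have e : (∫ x, f x * g (x + proj L z)) - ∫ x, f x * g x
      = ∫ x, f x * (g (x + proj L z) - g x) := by
    rw [← integral_sub (integrable_mul_of_memLp hf (memLp_translate hg _))
      (integrable_mul_of_memLp hf hg)]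
    simp only [mul_sub]
  rw [e]
  refine (abs_integral_mul_le hf ht).trans ?_
  have h1 := hη' z (hz.trans_lt (hJ j hj))
  have h2 := nrm_nonneg p f
  calc nrm p f * nrm q (fun x => g (x + proj L z) - g x)
      ≤ (nrm p f + 1) * (ε / (2 * (nrm p f + 1))) := by
        exact mul_le_mul (by linarith) h1 (nrm_nonneg _ _) (by linarith)
    _ = ε / 2 := by field_simp

variable (L n) in
theorem exists_seq_isMollifier : ∃ (C : ℝ) (δ : ℕ → ℝ) (ρ : ℕ → Vec n → ℝ), 0 ≤ C ∧
    (∀ j, IsMollifier L C (δ j) (ρ j)) ∧ (∀ j, 0 < δ j ∧ δ j ≤ 1) ∧ Tendsto δ atTop (𝓝 0) := by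
  have hL : 0 < L := Fact.out
  obtain ⟨C, hC, H⟩ := exists_isMollifier n L
  have hm : 0 < min 1 (L / 4) := lt_min one_pos (by positivity)
  set δ : ℕ → ℝ := fun j => min 1 (L / 4) / ((j : ℝ) + 1) with hδ
  have h1 : ∀ j, δ j ≤ min 1 (L / 4) := fun j =>
    div_le_self hm.le (by have : (0 : ℝ) ≤ j := j.cast_nonneg; linarith)
  have h0 : ∀ j, 0 < δ j := fun j => by simp only [hδ]; positivity
  choose! ρ hρ using H
  refine ⟨C, δ, fun j => ρ (δ j), hC, fun j => hρ _ (h0 j) ?_,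
    fun j => ⟨h0 j, (h1 j).trans (min_le_left _ _)⟩, ?_⟩
  · have := (h1 j).trans (min_le_right _ _)
    linarith
  · have := (tendsto_one_div_add_atTop_nhds_zero_nat (𝕜 := ℝ)).const_mul (min 1 (L / 4))
    simpa only [mul_one_div, mul_zero] using this

/-! ### Weak partial derivatives: uniqueness and integrability -/

theorem IsWeakPartial.ae_eq {k : Fin n} {f₁ g₁ g₂ : Torus L n → ℝ} (h₁ : IsWeakPartial k f₁ g₁)
    (h₂ : IsWeakPartial k f₁ g₂) (hg₁ : MemLp g₁ 2 volume) (hg₂ : MemLp g₂ 2 volume) :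
    g₁ =ᵐ[volume] g₂ := by
  obtain ⟨C, δ, ρ, -, hρ, -, hδ⟩ := exists_seq_isMollifier L n
  have hd : MemLp (fun x => g₁ x - g₂ x) 2 volume := hg₁.sub hg₂
  have hdi : Integrable (fun x => g₁ x - g₂ x) volume := hd.integrable (by norm_num)
  have h := tendsto_integral_mul_avg hρ hδ hd hd
  have h0 : ∀ j, ∫ x, (g₁ x - g₂ x) * avg (ρ j) (fun x => g₁ x - g₂ x) x = 0 := by
    intro j
    have hk := (hρ j).isKernel
    have e1 := h₁ _ (hk.isSmooth_avg (hρ j).contDiff hdi)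
    have e2 := h₂ _ (hk.isSmooth_avg (hρ j).contDiff hdi)
    obtain ⟨c, -, hc⟩ := hk.exists_bound
    have hb : ∀ g : Torus L n → ℝ, MemLp g 2 volume → Integrable
        (fun x => g x * avg (ρ j) (fun x => g₁ x - g₂ x) x) volume := fun g hg =>
      (hg.integrable (by norm_num)).mul_bdd (hk.continuous_avg hdi).aestronglyMeasurable
        (Eventually.of_forall (hk.abs_avg_le hc hdi))
    simp only [sub_mul]
    rw [integral_sub (hb _ hg₁) (hb _ hg₂)]
    linarith
  simp only [h0] at h
  have h2 := tendsto_nhds_unique h tendsto_const_nhds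
  have h3 := (integral_eq_zero_iff_of_nonneg (fun x => mul_self_nonneg _)
    (integrable_mul_of_memLp hd hd)).1 h2
  filter_upwards [h3] with x hx
  have : g₁ x - g₂ x = 0 := by simpa using hx
  linarith

/-- Integrating a weak derivative against a bounded function is controlled by the difference
quotients of the function. -/
theorem abs_integral_mul_weakPartial_le {k : Fin n} (hfg : IsWeakPartial k f g)
    (hf : MemLp f 3 volume) (hg : MemLp g 2 volume) {M : ℝ} (hM : 0 ≤ M)
    (hlip : ∀ z : Vec n, ‖z‖ ≤ 1 → nrm 3 (fun x => f (x + proj L z) - f x) ≤ M * ‖z‖)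
    {χ : Torus L n → ℝ} (hχ : AEStronglyMeasurable χ volume) {c : ℝ} (hc : ∀ x, ‖χ x‖ ≤ c) :
    |∫ x, χ x * g x| ≤ M * nrm (3 / 2) χ := by
  have hχp : ∀ p, MemLp χ p volume := fun p => MemLp.of_bound hχ c (Eventually.of_forall hc)
  have hχi : Integrable χ volume := (hχp 1).integrable le_rfl
  have hfi : Integrable f volume := hf.integrable Fact.out
  have hgi : Integrable g volume := hg.integrable (by norm_num)
  set Φ : Vec n → ℝ := fun z => ∫ x, χ x * f (x + proj L z) with hΦ
  have hχf : ∀ z, Integrable (fun x => χ x * f (x + proj L z)) volume := fun z =>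
    (integrable_translate hfi _).bdd_mul hχ (Eventually.of_forall hc)
  have hΦb : ∀ z, ‖Φ z‖ ≤ c * ∫ y, |f y| := by
    intro z
    have e : ∫ y, |f y| = ∫ y, |f (y + proj L z)| := (integral_add_right_eq_self _ _).symm
    rw [e, ← integral_const_mul]
    refine norm_integral_le_of_norm_le ((integrable_translate hfi _).abs.const_mul c)
      (Eventually.of_forall fun x => ?_)
    rw [norm_mul, Real.norm_eq_abs (f _)]
    exact mul_le_mul_of_nonneg_right (hc x) (abs_nonneg _)
  have hΦm : AEStronglyMeasurable Φ volume :=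
    (hχ.comp_snd.mul (hf.1.comp_quasiMeasurePreserving
      quasiMeasurePreserving_translate)).integral_prod_right'
  have hΦl : LocallyIntegrable Φ volume :=
    (memLp_top_of_bound hΦm _ (Eventually.of_forall hΦb)).locallyIntegrable le_top
  have hΦd : ∀ (z w : Vec n), ‖w‖ ≤ 1 → |Φ (z + w) - Φ z| ≤ nrm (3 / 2) χ * (M * ‖w‖) := by
    intro z w hw
    rw [hΦ]
    simp only
    rw [← integral_sub (hχf _) (hχf _)]
    simp only [← mul_sub]
    have hm : MemLp (fun x => f (x + proj L w) - f x) 3 volume := (memLp_translate hf _).sub hf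
    have hm2 := memLp_translate hm (proj L z)
    have e : ∀ x, f (x + proj L (z + w)) - f (x + proj L z)
        = f (x + proj L z + proj L w) - f (x + proj L z) := by
      intro x; rw [proj_add, add_assoc]
    simp only [e]
    refine (abs_integral_mul_le (hχp (3 / 2)) hm2).trans ?_
    have h1 := nrm_translate (p := 3) hm.1 (proj L z)
    rw [h1]
    exact mul_le_mul_of_nonneg_left (hlip w hw) (nrm_nonneg _ _)
  obtain ⟨C, δ, ρ, -, hρ, -, hδ⟩ := exists_seq_isMollifier L n
  have hlim := tendsto_integral_mul_avg hρ hδ (hχp 2) hg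
  refine le_of_tendsto hlim.abs (Eventually.of_forall fun j => ?_)
  have hk := (hρ j).isKernel
  have hder := hk.hasDerivAt_integral (hρ j).contDiff hΦl k
  have e : -∫ z, dker k (ρ j) z * Φ z = ∫ x, χ x * avg (ρ j) g x := by
    rw [hΦ, ← ((hρ j).isKernel_dker k).integral_mul_avg hχi hfi,
      hk.avg_dker (hρ j).contDiff hfi hgi hfg]
    simp only [mul_neg, integral_neg, neg_neg]
  rw [e] at hder
  refine hder.le_of_lip' (mul_nonneg hM (nrm_nonneg _ _)) ?_
  filter_upwards [Metric.ball_mem_nhds (0 : ℝ) one_pos] with t ht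
  have ht1 : |t| ≤ 1 := by
    have : |t| < 1 := by simpa using ht
    exact this.le
  have hnw : ‖t • (EuclideanSpace.single k 1 : Vec n)‖ = |t| := by simp [norm_smul]
  have hi : ∀ w : Vec n, Integrable (fun z => ρ j z * Φ (z + w)) volume := fun w =>
    hk.integrable.mul_bdd (hΦm.comp_measurePreserving (measurePreserving_add_right volume w))
      (Eventually.of_forall fun z => hΦb _)
  have hi0 : Integrable (fun z => ρ j z * Φ z) volume := by simpa using hi 0
  have e3 : (∫ z, ρ j z * Φ (z + t • EuclideanSpace.single k 1))
      - ∫ z, ρ j z * Φ (z + (0 : ℝ) • EuclideanSpace.single k 1)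
      = (∫ z, ρ j z * (Φ (z + t • EuclideanSpace.single k 1) - Φ z)) - 0 := by
    simp only [mul_sub, zero_smul, add_zero, sub_zero]
    rw [integral_sub (hi _) hi0]
  rw [e3, Real.norm_eq_abs, sub_zero t, Real.norm_eq_abs]
  refine (hρ j).abs_integral_mul_sub_le ?_ fun z _ => ?_
  · simp only [mul_sub]; exact (hi _).sub hi0
  · rw [sub_zero]
    refine (hΦd z _ (by rw [hnw]; exact ht1)).trans (le_of_eq ?_)
    rw [hnw]; ring

/-- The dual bound is tested with `g |g|`, where `g` is truncated to keep the test function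
bounded. -/
theorem eLpNorm_weakPartial_le {k : Fin n} (hfg : IsWeakPartial k f g)
    (hf : MemLp f 3 volume) (hg : MemLp g 2 volume) {M : ℝ} (hM : 0 ≤ M)
    (hlip : ∀ z : Vec n, ‖z‖ ≤ 1 → nrm 3 (fun x => f (x + proj L z) - f x) ≤ M * ‖z‖) :
    eLpNorm g 3 volume ≤ ENNReal.ofReal M := by
  wlog hgm : StronglyMeasurable g generalizing g
  · have h := this (g := hg.1.mk g) (fun ψ hψ => ?_) (hg.ae_eq hg.1.ae_eq_mk)
      hg.1.stronglyMeasurable_mk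
    · rwa [eLpNorm_congr_ae hg.1.ae_eq_mk]
    · rw [hfg ψ hψ]
      congr 1
      refine integral_congr_ae ?_
      filter_upwards [hg.1.ae_eq_mk] with x hx
      rw [hx]
  set G : ℕ → Torus L n → ℝ := fun N => {x | |g x| ≤ N}.indicator g with hG
  have hset : ∀ N : ℕ, MeasurableSet {x | |g x| ≤ (N : ℝ)} := fun N =>
    measurableSet_le hgm.measurable.abs measurable_const
  have hGm : ∀ N, StronglyMeasurable (G N) := fun N => hgm.indicator (hset N)
  have hGb : ∀ N x, |G N x| ≤ N := by
    intro N x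
    by_cases hx : |g x| ≤ N
    · rw [hG]; simp only; rwa [indicator_of_mem (by exact hx)]
    · rw [hG]; simp only; rw [indicator_of_notMem (by exact hx)]; simp
  have hGp : ∀ N p, MemLp (G N) p volume := fun N p =>
    MemLp.of_bound (hGm N).aestronglyMeasurable N (Eventually.of_forall (hGb N))
  have hbound : ∀ N, eLpNorm (G N) 3 volume ≤ ENNReal.ofReal M := by
    intro N
    have h1 := abs_integral_mul_weakPartial_le hfg hf hg hM hlip
      (χ := fun x => G N x * |G N x|) (c := N * N)
      ((hGm N).aestronglyMeasurable.mul (hGm N).aestronglyMeasurable.norm) (fun x => by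
        rw [norm_mul, Real.norm_eq_abs, Real.norm_eq_abs, abs_abs]
        exact mul_le_mul (hGb N x) (hGb N x) (abs_nonneg _) (Nat.cast_nonneg N))
    have h2 := nrm_mul_le (r := 3 / 2) (hGp N 3) (hGp N 3).norm
    have h3 : nrm 3 (fun x => ‖G N x‖) = nrm 3 (G N) := by rw [nrm, nrm, eLpNorm_norm]
    rw [h3] at h2
    have e : ∫ x, G N x * |G N x| * g x = nrm 3 (G N) ^ 3 := by
      have e1 : ∀ x, G N x * |G N x| * g x = ‖G N x‖ ^ (3 : ℝ) := by
        intro x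
        have : ‖G N x‖ ^ (3 : ℝ) = |G N x| ^ 3 := by
          rw [Real.norm_eq_abs]; exact_mod_cast Real.rpow_natCast (|G N x|) 3
        rw [this]
        by_cases hx : x ∈ {x | |g x| ≤ (N : ℝ)}
        · have : G N x = g x := indicator_of_mem hx g
          rw [this]
          have h4 := abs_mul_abs_self (g x)
          calc g x * |g x| * g x = (g x * g x) * |g x| := by ring
            _ = |g x| ^ 3 := by rw [← h4]; ring
        · have : G N x = 0 := indicator_of_notMem hx g
          rw [this]; simp
      simp only [e1]
      rw [nrm, (hGp N 3).eLpNorm_eq_integral_rpow_norm (by simp) (by simp),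
        ENNReal.toReal_ofReal (by positivity)]
      have h5 : 0 ≤ ∫ x, ‖G N x‖ ^ (3 : ℝ) := integral_nonneg fun x => by positivity
      simp only [ENNReal.toReal_ofNat]
      rw [← Real.rpow_natCast, ← Real.rpow_mul h5]
      norm_num
    rw [e, abs_of_nonneg (pow_nonneg (nrm_nonneg _ _) 3)] at h1
    have h4 : nrm 3 (G N) ≤ M := by
      rcases (nrm_nonneg 3 (G N)).eq_or_lt with h0 | h0
      · rw [← h0]; exact hM
      · have h5 : nrm 3 (G N) * (nrm 3 (G N) * nrm 3 (G N))
            ≤ M * (nrm 3 (G N) * nrm 3 (G N)) := by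
          refine le_trans (le_of_eq (by ring)) (h1.trans (mul_le_mul_of_nonneg_left h2 hM))
        exact le_of_mul_le_mul_right h5 (by positivity)
    exact (ENNReal.le_ofReal_iff_toReal_le (hGp N 3).eLpNorm_ne_top hM).2 h4
  have hlim : ∀ x, Tendsto (fun N => G N x) atTop (𝓝 (g x)) := by
    intro x
    refine tendsto_const_nhds.congr' ?_
    filter_upwards [eventually_ge_atTop ⌈|g x|⌉₊] with N hN
    exact (indicator_of_mem (show x ∈ {x | |g x| ≤ (N : ℝ)} from Nat.ceil_le.1 hN) g).symm
  refine (Lp.eLpNorm_lim_le_liminf_eLpNorm (fun N => (hGm N).aestronglyMeasurable) g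
    (Eventually.of_forall hlim)).trans ?_
  refine (liminf_le_liminf (Eventually.of_forall hbound)).trans (le_of_eq ?_)
  exact liminf_const _

end Holder

/-! ### The commutator estimate and the energy flux -/

section Flux

variable {L : ℝ} {n : ℕ} [Fact (0 < L)]

/-- The trilinear form `∫ a b (K-average of w)`, to which every term of the weak formulation
reduces when the test field is an average. -/
def tri (K : Vec n → ℝ) (a b w : Torus L n → ℝ) : ℝ := ∫ x, a x * b x * avg K w x

theorem integrable_mul_three {a b c : Torus L n → ℝ} (ha : MemLp a 3 volume)
    (hb : MemLp b 3 volume) (hc : MemLp c 3 volume) :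
    Integrable (fun x => a x * b x * c x) volume :=
  integrable_mul_of_memLp (p := 3 / 2) (q := 3) (memLp_mul ha hb) hc

theorem abs_integral_mul_three_le {a b c : Torus L n → ℝ} (ha : MemLp a 3 volume)
    (hb : MemLp b 3 volume) (hc : MemLp c 3 volume) :
    |∫ x, a x * b x * c x| ≤ nrm 3 a * nrm 3 b * nrm 3 c :=
  (abs_integral_mul_le (p := 3 / 2) (q := 3) (memLp_mul ha hb) hc).trans
    (mul_le_mul_of_nonneg_right (nrm_mul_le ha hb) (nrm_nonneg _ _))

theorem integrable_mul_of_memLp_three {a b : Torus L n → ℝ} (ha : MemLp a 3 volume)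
    (hb : MemLp b 3 volume) : Integrable (fun x => a x * b x) volume :=
  (memLp_mul (r := 3 / 2) ha hb).integrable (ENNReal.HolderTriple.le (3 / 2) 3 1)

variable {C δ : ℝ} {ρ : Vec n → ℝ}

theorem IsMollifier.abs_tri_le (hρ : IsMollifier L C δ ρ) {a b w : Torus L n → ℝ}
    (ha : MemLp a 3 volume) (hb : MemLp b 3 volume) (hw : MemLp w 3 volume) :
    |tri ρ a b w| ≤ nrm 3 a * nrm 3 b * nrm 3 w := by
  have hab := integrable_mul_of_memLp_three ha hb
  have hwi : Integrable w volume := hw.integrable Fact.out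
  have h := hρ.abs_integral_mul_sub_le (a := 0) (κ := nrm 3 a * nrm 3 b * nrm 3 w)
    (hρ.isKernel.integrable_corr hab hwi) (fun z _ => by
      rw [sub_zero]
      have := abs_integral_mul_three_le ha hb (memLp_translate hw (proj L z))
      rwa [nrm_translate hw.1] at this)
  rwa [sub_zero, ← hρ.isKernel.integral_mul_avg hab hwi] at h

/-- As the kernel `∂ₖρ` is odd, `a` can be replaced by half a difference of `a`; subtracting a term
that involves only the average of `a` produces a difference of `w` as well. -/
theorem IsMollifier.two_mul_tri_dker (hρ : IsMollifier L C δ ρ) (k : Fin n)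
    {a w : Torus L n → ℝ} (ha : MemLp a 3 volume) (hw : MemLp w 3 volume) :
    2 * tri (dker k ρ) a w w =
      (∫ z, dker k ρ z * ∫ x, (a (x + proj L z) - a x) * w x * (w x - w (x + proj L z)))
        - ∫ x, w x * w x * avg (dker k ρ) a x := by
  have hK := hρ.isKernel_dker k
  set K := dker k ρ with hKdef
  have hodd : ∀ z, K (-z) = -K z := dker_odd hρ.contDiff hρ.even k
  have haw := integrable_mul_of_memLp_three ha hw
  have hww := integrable_mul_of_memLp_three hw hw
  have hwi : Integrable w volume := hw.integrable Fact.out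
  have hai : Integrable a volume := ha.integrable Fact.out
  set P : Vec n → ℝ := fun z => ∫ x, a x * w x * w (x + proj L z) with hP
  set Q : Vec n → ℝ := fun z => ∫ x, w x * w x * a (x + proj L z) with hQ
  have hPi : Integrable (fun z => K z * P z) volume := hK.integrable_corr haw hwi
  have hQi : Integrable (fun z => K z * Q z) volume := hK.integrable_corr hww hai
  have hPi' : Integrable (fun z => K z * P (-z)) volume := by
    have := hPi.comp_neg.neg
    refine this.congr (Eventually.of_forall fun z => ?_)
    simp [hodd]
  have hPneg : ∫ z, K z * P (-z) = -∫ z, K z * P z := by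
    rw [← integral_neg_eq_self, ← integral_neg]
    congr 1; ext z
    rw [hodd, neg_neg, neg_mul]
  have hR : ∀ z, ∫ x, (a (x + proj L z) - a x) * w x * (w x - w (x + proj L z))
      = P z - P (-z) - (∫ x, a x * w x * w x) + Q z := by
    intro z
    have hat := memLp_translate ha (proj L z)
    have hwt := memLp_translate hw (proj L z)
    have e1 : P (-z) = ∫ x, a (x + proj L z) * w x * w (x + proj L z) := by
      rw [hP]
      simp only
      rw [integral_mul_translate_neg (fun x => a x * w x) w z]
      congr 1; ext x; ring
    have e2 : Q z = ∫ x, a (x + proj L z) * w x * w x := by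
      rw [hQ]; refine integral_congr_ae (Eventually.of_forall fun x => ?_); simp only; ring
    rw [e1, e2, hP]
    simp only
    have i1 := integrable_mul_three ha hw hwt
    have i2 := integrable_mul_three hat hw hwt
    have i3 := integrable_mul_three ha hw hw
    have i4 := integrable_mul_three hat hw hw
    have i12 := integral_sub i1 i2
    have i123 := integral_sub (i1.sub i2) i3
    have i1234 := integral_add ((i1.sub i2).sub i3) i4
    simp only [Pi.sub_apply] at i123 i1234
    rw [← i12, ← i123, ← i1234]
    congr 1; ext x; ring
  have e : tri K a w w = ∫ z, K z * P z := hK.integral_mul_avg haw hwi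
  have e' : ∫ x, w x * w x * avg K a x = ∫ z, K z * Q z := hK.integral_mul_avg hww hai
  rw [e, e']
  simp only [hR]
  simp only [mul_add, mul_sub]
  have hKi := hK.integrable.mul_const (∫ x, a x * w x * w x)
  have i1 := integral_sub hPi hPi'
  have i2 := integral_sub (hPi.sub hPi') hKi
  have i3 := integral_add ((hPi.sub hPi').sub hKi) hQi
  simp only [Pi.sub_apply] at i2 i3
  rw [i3, i2, i1, hPneg, integral_mul_const, hρ.integral_dker k]
  ring

/-- The commutator estimate: transport by a divergence-free field that is Lipschitz in the mean
is antisymmetric up to an error controlled by the modulus of continuity `κ` of `w` in `L³`. -/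
theorem IsMollifier.abs_sum_tri_dker_le (hρ : IsMollifier L C δ ρ) (hδ : δ ≤ 1)
    {v : Torus L n → Vec n} (hv : ∀ i, MemLp (fun x => v x i) 3 volume)
    (hdiv : IsWeaklyDivFree v) {w : Torus L n → ℝ} (hw : MemLp w 3 volume) {M κ : ℝ}
    (hM : 0 ≤ M) (hκ : 0 ≤ κ)
    (hlip : ∀ i, ∀ z : Vec n, ‖z‖ ≤ 1 →
      nrm 3 (fun x => v (x + proj L z) i - v x i) ≤ M * ‖z‖)
    (hmod : ∀ z : Vec n, ‖z‖ ≤ δ → nrm 3 (fun x => w (x + proj L z) - w x) ≤ κ) :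
    |∑ k, tri (dker k ρ) (fun x => v x k) w w| ≤ n * (C * (M * nrm 3 w * κ)) := by
  have hww := integrable_mul_of_memLp_three hw hw
  have hvi : ∀ i, Integrable (fun x => v x i) volume := fun i => (hv i).integrable Fact.out
  have hz : ∑ k, ∫ x, w x * w x * avg (dker k ρ) (fun x => v x k) x = 0 := by
    rw [← integral_finsetSum]
    · simp only [← Finset.mul_sum, hρ.isKernel.sum_avg_dker hρ.contDiff hvi hdiv, mul_zero,
        integral_zero]
    · intro k _
      obtain ⟨c, -, hc⟩ := (hρ.isKernel_dker k).exists_bound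
      exact hww.mul_bdd ((hρ.isKernel_dker k).continuous_avg (hvi k)).aestronglyMeasurable
        (Eventually.of_forall ((hρ.isKernel_dker k).abs_avg_le hc (hvi k)))
  have hk : ∀ k : Fin n, |∫ z, dker k ρ z * ∫ x, (v (x + proj L z) k - v x k) * w x
      * (w x - w (x + proj L z))| ≤ C * (M * nrm 3 w * κ) := by
    intro k
    refine hρ.abs_integral_dker_mul_le k (by have := nrm_nonneg 3 w; positivity) fun z hz => ?_
    have h1 : MemLp (fun x => v (x + proj L z) k - v x k) 3 volume :=
      (memLp_translate (hv k) (proj L z)).sub (hv k)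
    have h2 : MemLp (fun x => w x - w (x + proj L z)) 3 volume :=
      hw.sub (memLp_translate hw (proj L z))
    refine (abs_integral_mul_three_le h1 hw h2).trans ?_
    have e : nrm 3 (fun x => w x - w (x + proj L z)) = nrm 3 (fun x => w (x + proj L z) - w x) := by
      rw [← nrm_neg 3 (fun x => w (x + proj L z) - w x)]
      simp only [neg_sub]
    rw [e]
    have h3 := hlip k z (hz.trans hδ)
    have h4 := hmod z hz
    have h5 := nrm_nonneg 3 w
    calc _ ≤ M * ‖z‖ * nrm 3 w * κ :=
          mul_le_mul (mul_le_mul_of_nonneg_right h3 h5) h4 (nrm_nonneg _ _) (by positivity)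
      _ = M * nrm 3 w * κ * ‖z‖ := by ring
  have h2 : 2 * ∑ k, tri (dker k ρ) (fun x => v x k) w w
      = ∑ k, ∫ z, dker k ρ z * ∫ x, (v (x + proj L z) k - v x k) * w x
        * (w x - w (x + proj L z)) := by
    rw [Finset.mul_sum]
    simp only [hρ.two_mul_tri_dker _ (hv _) hw, Finset.sum_sub_distrib, hz, sub_zero]
  have h3 : |2 * ∑ k, tri (dker k ρ) (fun x => v x k) w w| ≤ n * (C * (M * nrm 3 w * κ)) := by
    rw [h2]
    refine (Finset.abs_sum_le_sum_abs _ _).trans ((Finset.sum_le_sum fun k _ => hk k).trans ?_)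
    simp
  rw [abs_mul, abs_two] at h3
  linarith [abs_nonneg (∑ k, tri (dker k ρ) (fun x => v x k) w w)]

/-- The nonlinear part of the weak formulation at a velocity `v` with gradient `g`, tested with the
average of a velocity with gradient `g'`. -/
def flux (α : ℝ) (ρ : Vec n → ℝ) (v : Fin n → Torus L n → ℝ) (g g' : Fin n → Fin n → Torus L n → ℝ) :
    ℝ :=
  (∑ k, ∑ l, (tri ρ (v k) (v l) (g' k l) - α ^ 2 * (∑ j, tri ρ (g k j) (g l j) (g' k l))
    + α ^ 2 * ∑ j, tri ρ (g j k) (g j l) (g' k l)))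
  - α ^ 2 * ∑ k, ∑ j, ∑ l, tri (dker k ρ) (v k) (g j l) (g' j l)

theorem IsMollifier.tri_weakPartial (hρ : IsMollifier L C δ ρ) {k : Fin n}
    {f g : Torus L n → ℝ} (hf : Integrable f volume) (hg : Integrable g volume)
    (hfg : IsWeakPartial k f g) (a b : Torus L n → ℝ) :
    tri ρ a b g = -tri (dker k ρ) a b f := by
  rw [tri, tri, hρ.isKernel.avg_dker hρ.contDiff hf hg hfg, ← integral_neg]
  simp

/-- On the diagonal the flux consists of commutators and of terms cubic in the gradient. -/
theorem IsMollifier.flux_diag (hρ : IsMollifier L C δ ρ) (α : ℝ) {v : Fin n → Torus L n → ℝ}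
    {g : Fin n → Fin n → Torus L n → ℝ} (hv : ∀ i, Integrable (v i) volume)
    (hg : ∀ k l, Integrable (g k l) volume) (hvg : ∀ k l, IsWeakPartial k (v l) (g k l)) :
    flux α ρ v g g = -(∑ l, ∑ k, tri (dker k ρ) (v k) (v l) (v l))
      - α ^ 2 * (∑ j, ∑ l, ∑ k, tri (dker k ρ) (v k) (g j l) (g j l))
      + α ^ 2 * (∑ k, ∑ l, ∑ j, (tri ρ (g j k) (g j l) (g k l)
        - tri ρ (g k j) (g l j) (g k l))) := by
  have e1 : ∑ k, ∑ l, tri ρ (v k) (v l) (g k l)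
      = -(∑ l, ∑ k, tri (dker k ρ) (v k) (v l) (v l)) := by
    simp only [hρ.tri_weakPartial (hv _) (hg _ _) (hvg _ _), Finset.sum_neg_distrib]
    rw [Finset.sum_comm]
  have e2 : ∑ k, ∑ j, ∑ l, tri (dker k ρ) (v k) (g j l) (g j l)
      = ∑ j, ∑ l, ∑ k, tri (dker k ρ) (v k) (g j l) (g j l) := by
    rw [Finset.sum_comm]
    refine Finset.sum_congr rfl fun j _ => ?_
    rw [Finset.sum_comm]
  rw [flux, e2]
  simp only [Finset.sum_add_distrib, Finset.sum_sub_distrib, ← Finset.mul_sum, e1]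
  ring

/-- The two terms cubic in the gradient cancel: they differ by a cyclic permutation of the
indices. -/
theorem sum_cubic_eq_zero (g : Fin n → Fin n → Torus L n → ℝ) :
    ∑ k, ∑ l, ∑ j, ((∫ x, g j k x * g j l x * g k l x) - ∫ x, g k j x * g l j x * g k l x)
      = 0 := by
  simp only [Finset.sum_sub_distrib]
  rw [sub_eq_zero]
  have e : ∀ k l j, ∫ x, g k j x * g l j x * g k l x = ∫ x, g k l x * g k j x * g l j x := by
    intro k l j; congr 1; ext x; ring
  simp only [e]
  rw [Finset.sum_comm_cycle]

end Flux

/-! ### The flux vanishes in the limit for Besov velocities -/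

section FluxLimit

variable {L : ℝ} {n : ℕ} [Fact (0 < L)]

/-- A divergence-free velocity `v` with gradient `g` in `L³` that is Lipschitz in the mean; all the
relevant norms are bounded by `B`. -/
structure IsRegular (v : Torus L n → Vec n) (g : Fin n → Fin n → Torus L n → ℝ) (B : ℝ) :
    Prop where
  nonneg : 0 ≤ B
  div_free : IsWeaklyDivFree v
  memLp : ∀ i, MemLp (fun x => v x i) 3 volume
  memLp_grad : ∀ k i, MemLp (g k i) 3 volume
  isWeakPartial : ∀ k i, IsWeakPartial k (fun x => v x i) (g k i)
  nrm_le : ∀ i, nrm 3 (fun x => v x i) ≤ B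
  nrm_grad_le : ∀ k i, nrm 3 (g k i) ≤ B
  lipschitz : ∀ i, ∀ z : Vec n, ‖z‖ ≤ 1 →
    nrm 3 (fun x => v (x + proj L z) i - v x i) ≤ B * ‖z‖

variable {v : Torus L n → Vec n} {g : Fin n → Fin n → Torus L n → ℝ} {B : ℝ}

theorem IsRegular.integrable (h : IsRegular v g B) (i : Fin n) :
    Integrable (fun x => v x i) volume := (h.memLp i).integrable Fact.out

theorem IsRegular.integrable_grad (h : IsRegular v g B) (k i : Fin n) :
    Integrable (g k i) volume := (h.memLp_grad k i).integrable Fact.out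

theorem IsRegular.abs_sum_tri_le (h : IsRegular v g B) {C δ : ℝ} {ρ : Vec n → ℝ} (hC : 0 ≤ C)
    (hρ : IsMollifier L C δ ρ) (hδ : δ ≤ 1) {w : Torus L n → ℝ} (hw : MemLp w 3 volume)
    (hwB : nrm 3 w ≤ B) :
    |∑ k, tri (dker k ρ) (fun x => v x k) w w| ≤ 2 * n * C * B ^ 3 := by
  have hB := h.nonneg
  refine (hρ.abs_sum_tri_dker_le hδ h.memLp h.div_free hw hB (κ := B + B) (by positivity)
    h.lipschitz fun z _ => ?_).trans ?_
  · have h1 := nrm_sub_le (by norm_num) (memLp_translate hw (proj L z)) hw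
    rw [nrm_translate hw.1] at h1
    linarith
  · calc (n : ℝ) * (C * (B * nrm 3 w * (B + B))) ≤ n * (C * (B * B * (B + B))) := by gcongr
      _ = 2 * n * C * B ^ 3 := by ring

/-- A bound of the flux of a regular velocity that is uniform in the scale of the mollifier. -/
theorem IsRegular.abs_flux_le (h : IsRegular v g B) {C δ : ℝ} {ρ : Vec n → ℝ} (hC : 0 ≤ C)
    (hρ : IsMollifier L C δ ρ) (hδ : δ ≤ 1) (α : ℝ) :
    |flux α ρ (fun i x => v x i) g g|
      ≤ (n * (2 * n * C) + α ^ 2 * (n * (n * (2 * n * C))) + α ^ 2 * (n * (n * (n * 2))))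
        * B ^ 3 := by
  have hB := h.nonneg
  rw [hρ.flux_diag α h.integrable h.integrable_grad h.isWeakPartial]
  have b1 : |∑ l, ∑ k, tri (dker k ρ) (fun x => v x k) (fun x => v x l) (fun x => v x l)|
      ≤ n * (2 * n * C * B ^ 3) := by
    refine (Finset.abs_sum_le_sum_abs _ _).trans ((Finset.sum_le_sum fun l _ =>
      h.abs_sum_tri_le hC hρ hδ (h.memLp l) (h.nrm_le l)).trans ?_)
    simp
  have b2 : |∑ j, ∑ l, ∑ k, tri (dker k ρ) (fun x => v x k) (g j l) (g j l)|
      ≤ n * (n * (2 * n * C * B ^ 3)) := by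
    refine (Finset.abs_sum_le_sum_abs _ _).trans ((Finset.sum_le_sum fun j _ =>
      (Finset.abs_sum_le_sum_abs _ _).trans (Finset.sum_le_sum fun l _ =>
      h.abs_sum_tri_le hC hρ hδ (h.memLp_grad j l) (h.nrm_grad_le j l))).trans ?_)
    simp
  have b0 : ∀ a b c d e f, |tri ρ (g a b) (g c d) (g e f)| ≤ B ^ 3 := by
    intro a b c d e f
    refine (hρ.abs_tri_le (h.memLp_grad a b) (h.memLp_grad c d) (h.memLp_grad e f)).trans ?_
    have := nrm_nonneg 3 (g e f)
    have := nrm_nonneg 3 (g c d)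
    calc _ ≤ B * B * B := by
          gcongr
          · exact h.nrm_grad_le a b
          · exact h.nrm_grad_le c d
          · exact h.nrm_grad_le e f
      _ = B ^ 3 := by ring
  have b3 : |∑ k, ∑ l, ∑ j, (tri ρ (g j k) (g j l) (g k l) - tri ρ (g k j) (g l j) (g k l))|
      ≤ n * (n * (n * (2 * B ^ 3))) := by
    refine (Finset.abs_sum_le_sum_abs _ _).trans ((Finset.sum_le_sum fun k _ =>
      (Finset.abs_sum_le_sum_abs _ _).trans (Finset.sum_le_sum fun l _ =>
      (Finset.abs_sum_le_sum_abs _ _).trans (Finset.sum_le_sum fun j _ =>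
        ((abs_sub _ _).trans (add_le_add (b0 j k j l k l) (b0 k j l j k l)))))).trans
          (le_of_eq ?_))
    simp only [Finset.sum_const, Finset.card_univ, Fintype.card_fin, nsmul_eq_mul]
    ring
  have hα : 0 ≤ α ^ 2 := sq_nonneg α
  refine (abs_add_le _ _).trans ((add_le_add (abs_sub _ _) le_rfl).trans ?_)
  rw [abs_neg, abs_mul, abs_mul, abs_of_nonneg hα]
  have c2 := mul_le_mul_of_nonneg_left b2 hα
  have c3 := mul_le_mul_of_nonneg_left b3 hα
  linarith

theorem IsRegular.tendsto_sum_tri (h : IsRegular v g B) {C : ℝ} {δ : ℕ → ℝ}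
    {ρ : ℕ → Vec n → ℝ} (hC : 0 ≤ C) (hρ : ∀ j, IsMollifier L C (δ j) (ρ j))
    (hδ1 : ∀ j, δ j ≤ 1) (hδ : Tendsto δ atTop (𝓝 0)) {w : Torus L n → ℝ}
    (hw : MemLp w 3 volume) :
    Tendsto (fun j => ∑ k, tri (dker k (ρ j)) (fun x => v x k) w w) atTop (𝓝 0) := by
  have hB := h.nonneg
  have hw0 := nrm_nonneg 3 w
  rw [Metric.tendsto_atTop]
  intro ε hε
  set D : ℝ := n * (C * (B * nrm 3 w)) with hD
  have hD0 : 0 ≤ D := by positivity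
  obtain ⟨η, hη, hη'⟩ := exists_nrm_translate_sub_le hw (show 0 < ε / (2 * (D + 1)) by positivity)
  obtain ⟨J, hJ⟩ := eventually_atTop.1 (hδ.eventually (gt_mem_nhds hη))
  refine ⟨J, fun j hj => ?_⟩
  rw [Real.dist_eq, sub_zero]
  refine ((hρ j).abs_sum_tri_dker_le (hδ1 j) h.memLp h.div_free hw hB
    (κ := ε / (2 * (D + 1))) (by positivity) h.lipschitz
    fun z hz => hη' z (hz.trans_lt (hJ j hj))).trans_lt ?_
  calc (n : ℝ) * (C * (B * nrm 3 w * (ε / (2 * (D + 1))))) = D * (ε / (2 * (D + 1))) := by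
        rw [hD]; ring
    _ ≤ (D + 1) * (ε / (2 * (D + 1))) := by gcongr; linarith
    _ = ε / 2 := by field_simp
    _ < ε := by linarith

/-- The energy flux of a regular velocity through the scale of the mollifier tends to zero. -/
theorem IsRegular.tendsto_flux (h : IsRegular v g B) {C : ℝ} {δ : ℕ → ℝ}
    {ρ : ℕ → Vec n → ℝ} (hC : 0 ≤ C) (hρ : ∀ j, IsMollifier L C (δ j) (ρ j))
    (hδ1 : ∀ j, δ j ≤ 1) (hδ : Tendsto δ atTop (𝓝 0)) (α : ℝ) :
    Tendsto (fun j => flux α (ρ j) (fun i x => v x i) g g) atTop (𝓝 0) := by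
  simp only [fun j => (hρ j).flux_diag α h.integrable h.integrable_grad h.isWeakPartial]
  have t1 : Tendsto (fun j => ∑ l, ∑ k,
      tri (dker k (ρ j)) (fun x => v x k) (fun x => v x l) (fun x => v x l)) atTop
      (𝓝 (∑ l : Fin n, 0)) :=
    tendsto_finsetSum _ fun l _ => h.tendsto_sum_tri hC hρ hδ1 hδ (h.memLp l)
  have t2 : Tendsto (fun j => ∑ i, ∑ l, ∑ k,
      tri (dker k (ρ j)) (fun x => v x k) (g i l) (g i l)) atTop
      (𝓝 (∑ i : Fin n, ∑ l : Fin n, 0)) :=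
    tendsto_finsetSum _ fun i _ => tendsto_finsetSum _ fun l _ =>
      h.tendsto_sum_tri hC hρ hδ1 hδ (h.memLp_grad i l)
  have t0 : ∀ a b c d e f, Tendsto (fun j => tri (ρ j) (g a b) (g c d) (g e f)) atTop
      (𝓝 (∫ x, g a b x * g c d x * g e f x)) := fun a b c d e f =>
    tendsto_integral_mul_avg (p := 3 / 2) (q := 3) hρ hδ
      (memLp_mul (h.memLp_grad a b) (h.memLp_grad c d)) (h.memLp_grad e f)
  have t3 : Tendsto (fun i => ∑ k, ∑ l, ∑ j,
      (tri (ρ i) (g j k) (g j l) (g k l) - tri (ρ i) (g k j) (g l j) (g k l))) atTop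
      (𝓝 (∑ k, ∑ l, ∑ j,
        ((∫ x, g j k x * g j l x * g k l x) - ∫ x, g k j x * g l j x * g k l x))) :=
    tendsto_finsetSum _ fun k _ => tendsto_finsetSum _ fun l _ => tendsto_finsetSum _ fun j _ =>
      (t0 j k j l k l).sub (t0 k j l j k l)
  rw [sum_cubic_eq_zero] at t3
  have := (t1.neg.sub (t2.const_mul (α ^ 2))).add (t3.const_mul (α ^ 2))
  simpa using this

theorem MemH1.memLp_grad {f : Torus L n → Vec n} (h : MemH1 f) (k i : Fin n) :
    MemLp (grad f k i) 2 volume := by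
  rw [grad, weakPartial, dif_pos (h.2 k i)]
  exact (h.2 k i).choose_spec.1

theorem MemH1.isWeakPartial_grad {f : Torus L n → Vec n} (h : MemH1 f) (k i : Fin n) :
    IsWeakPartial k (fun x => f x i) (grad f k i) := by
  rw [grad, weakPartial, dif_pos (h.2 k i)]
  exact (h.2 k i).choose_spec.2

theorem aestronglyMeasurable_apply {f : Torus L n → Vec n} (h : AEStronglyMeasurable f volume)
    (i : Fin n) : AEStronglyMeasurable (fun x => f x i) volume :=
  (by fun_prop : Continuous fun v : Vec n => v i).comp_aestronglyMeasurable h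

theorem eLpNorm_apply_le (f : Torus L n → Vec n) (i : Fin n) (p : ℝ≥0∞) :
    eLpNorm (fun x => f x i) p volume ≤ eLpNorm f p volume :=
  eLpNorm_mono fun x => PiLp.norm_apply_le (f x) i

theorem memLp_apply {p : ℝ≥0∞} {f : Torus L n → Vec n} (h : MemLp f p volume) (i : Fin n) :
    MemLp (fun x => f x i) p volume :=
  ⟨aestronglyMeasurable_apply h.1 i, (eLpNorm_apply_le f i p).trans_lt h.2⟩

theorem nrm_apply_le {p : ℝ≥0∞} {f : Torus L n → Vec n} (h : MemLp f p volume) (i : Fin n) :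
    nrm p (fun x => f x i) ≤ nrm p f :=
  ENNReal.toReal_mono h.eLpNorm_ne_top (eLpNorm_apply_le f i p)

theorem exists_isRegular (L : ℝ) [Fact (0 < L)] (n : ℕ) {s : ℝ} (hs : 1 < s) :
    ∃ C : ℝ, 0 ≤ C ∧ ∀ f : Torus L n → Vec n, MemH1 f → IsWeaklyDivFree f →
      besovNorm s 3 f ≠ ⊤ → IsRegular f (grad f) (C * (besovNorm s 3 f).toReal) := by
  obtain ⟨C, hC, H⟩ := exists_lipschitz_besov L n hs
  refine ⟨C + 1, by positivity, fun f hf hdiv hb => ?_⟩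
  have hfb : eLpNorm f 3 volume ≤ besovNorm s 3 f := le_self_add
  have hmem : MemLp f 3 volume := ⟨hf.1.1, hfb.trans_lt hb.lt_top⟩
  have hb0 : 0 ≤ (besovNorm s 3 f).toReal := ENNReal.toReal_nonneg
  have hA : nrm 3 f ≤ (besovNorm s 3 f).toReal := ENNReal.toReal_mono hb hfb
  have hC1 : C * (besovNorm s 3 f).toReal ≤ (C + 1) * (besovNorm s 3 f).toReal := by
    linarith
  have hC2 : (besovNorm s 3 f).toReal ≤ (C + 1) * (besovNorm s 3 f).toReal := by
    have := mul_nonneg hC hb0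
    linarith
  have hB : 0 ≤ (C + 1) * (besovNorm s 3 f).toReal := by positivity
  have hlip : ∀ i, ∀ z : Vec n, ‖z‖ ≤ 1 → nrm 3 (fun x => f (x + proj L z) i - f x i)
      ≤ (C + 1) * (besovNorm s 3 f).toReal * ‖z‖ := by
    intro i z hz
    have h1 : MemLp (fun x => f (x + proj L z) - f x) 3 volume :=
      (memLp_translate hmem (proj L z)).sub hmem
    refine (nrm_apply_le h1 i).trans ((H f hf.1.1 hb z hz).trans ?_)
    exact mul_le_mul_of_nonneg_right hC1 (norm_nonneg z)
  have hg : ∀ k i, eLpNorm (grad f k i) 3 volume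
      ≤ ENNReal.ofReal ((C + 1) * (besovNorm s 3 f).toReal) := fun k i =>
    eLpNorm_weakPartial_le (hf.isWeakPartial_grad k i) (memLp_apply hmem i) (hf.memLp_grad k i)
      hB (hlip i)
  exact ⟨hB, hdiv, memLp_apply hmem, fun k i => ⟨(hf.memLp_grad k i).1,
    (hg k i).trans_lt ENNReal.ofReal_lt_top⟩, hf.isWeakPartial_grad,
    fun i => (nrm_apply_le hmem i).trans (hA.trans hC2),
    fun k i => ENNReal.toReal_le_of_le_ofReal hB (hg k i), hlip⟩

end FluxLimit

/-! ### Continuity with respect to the `L²` norm -/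

section LTwo

variable {L : ℝ} {n : ℕ} [Fact (0 < L)]

theorem integral_abs_le_nrm_two {w : Torus L n → ℝ} (hw : MemLp w 2 volume) :
    ∫ x, |w x| ≤ nrm 2 w * nrm 2 (fun _ : Torus L n => (1 : ℝ)) := by
  have h := abs_integral_mul_le (p := 2) (q := 2) hw.norm (memLp_const (1 : ℝ))
  have e : nrm 2 (fun x => ‖w x‖) = nrm 2 w := congrArg ENNReal.toReal (eLpNorm_norm w)
  simp only [mul_one, e] at h
  exact (le_abs_self _).trans h

variable {K : Vec n → ℝ}

theorem IsKernel.integrable_tri (hK : IsKernel L K) {a b w : Torus L n → ℝ}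
    (ha : MemLp a 2 volume) (hb : MemLp b 2 volume) (hw : Integrable w volume) :
    Integrable (fun x => a x * b x * avg K w x) volume := by
  obtain ⟨c, -, hc⟩ := hK.exists_bound
  exact (integrable_mul_of_memLp ha hb).mul_bdd (hK.continuous_avg hw).aestronglyMeasurable
    (Eventually.of_forall (hK.abs_avg_le hc hw))

theorem IsKernel.exists_abs_tri_le (hK : IsKernel L K) : ∃ c, 0 ≤ c ∧ ∀ a b w : Torus L n → ℝ,
    MemLp a 2 volume → MemLp b 2 volume → MemLp w 2 volume →
    |tri K a b w| ≤ c * (nrm 2 a * nrm 2 b * nrm 2 w) := by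
  obtain ⟨c, hc0, hc⟩ := hK.exists_bound
  refine ⟨c * nrm 2 (fun _ : Torus L n => (1 : ℝ)), mul_nonneg hc0 (nrm_nonneg _ _),
    fun a b w ha hb hw => ?_⟩
  have hwi : Integrable w volume := hw.integrable (by norm_num)
  have h1 : ∀ x, |avg K w x| ≤ c * (nrm 2 w * nrm 2 (fun _ : Torus L n => (1 : ℝ))) := fun x =>
    (hK.abs_avg_le hc hwi x).trans (mul_le_mul_of_nonneg_left (integral_abs_le_nrm_two hw) hc0)
  have hab := integrable_mul_of_memLp ha hb
  have h2 : ∫ x, |a x * b x| ≤ nrm 2 a * nrm 2 b := by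
    have h := abs_integral_mul_le (p := 2) (q := 2) ha.norm hb.norm
    have e : ∀ f : Torus L n → ℝ, nrm 2 (fun x => ‖f x‖) = nrm 2 f := fun f =>
      congrArg ENNReal.toReal (eLpNorm_norm f)
    simp only [e] at h
    simp only [abs_mul]
    exact (le_abs_self _).trans h
  have h3 : |tri K a b w| ≤ ∫ x, |a x * b x| *
      (c * (nrm 2 w * nrm 2 (fun _ : Torus L n => (1 : ℝ)))) := by
    rw [← Real.norm_eq_abs]
    refine norm_integral_le_of_norm_le (hab.abs.mul_const _) (Eventually.of_forall fun x => ?_)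
    rw [norm_mul]
    exact mul_le_mul_of_nonneg_left (h1 x) (abs_nonneg _)
  rw [integral_mul_const] at h3
  refine h3.trans ((mul_le_mul_of_nonneg_right h2 ?_).trans (le_of_eq (by ring)))
  have := nrm_nonneg 2 w
  have := nrm_nonneg 2 (fun _ : Torus L n => (1 : ℝ))
  positivity

theorem IsKernel.tri_sub_tri (hK : IsKernel L K) {a b w a' b' w' : Torus L n → ℝ}
    (ha : MemLp a 2 volume) (hb : MemLp b 2 volume) (hw : MemLp w 2 volume)
    (ha' : MemLp a' 2 volume) (hb' : MemLp b' 2 volume) (hw' : MemLp w' 2 volume) :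
    tri K a b w - tri K a' b' w' = tri K (fun x => a x - a' x) b w
      + tri K a' (fun x => b x - b' x) w + tri K a' b' (fun x => w x - w' x) := by
  have hwi : Integrable w volume := hw.integrable (by norm_num)
  have hwi' : Integrable w' volume := hw'.integrable (by norm_num)
  have e1 : tri K (fun x => a x - a' x) b w = tri K a b w - tri K a' b w := by
    rw [tri, tri, tri, ← integral_sub (hK.integrable_tri ha hb hwi) (hK.integrable_tri ha' hb hwi)]
    congr 1; ext x; ring
  have e2 : tri K a' (fun x => b x - b' x) w = tri K a' b w - tri K a' b' w := by
    rw [tri, tri, tri, ← integral_sub (hK.integrable_tri ha' hb hwi)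
      (hK.integrable_tri ha' hb' hwi)]
    congr 1; ext x; ring
  have e3 : tri K a' b' (fun x => w x - w' x) = tri K a' b' w - tri K a' b' w' := by
    rw [tri, tri, tri, ← integral_sub (hK.integrable_tri ha' hb' hwi)
      (hK.integrable_tri ha' hb' hwi')]
    congr 1; ext x
    rw [hK.avg_sub hwi hwi']; ring
  rw [e1, e2, e3]; ring

theorem IsKernel.tendsto_tri (hK : IsKernel L K) {ι : Type*} {l : Filter ι}
    {a b w : ι → Torus L n → ℝ} {a₀ b₀ w₀ : Torus L n → ℝ}
    (ha : ∀ᶠ i in l, MemLp (a i) 2 volume) (hb : ∀ᶠ i in l, MemLp (b i) 2 volume)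
    (hw : ∀ᶠ i in l, MemLp (w i) 2 volume) (ha₀ : MemLp a₀ 2 volume) (hb₀ : MemLp b₀ 2 volume)
    (hw₀ : MemLp w₀ 2 volume)
    (ta : Tendsto (fun i => nrm 2 (fun x => a i x - a₀ x)) l (𝓝 0))
    (tb : Tendsto (fun i => nrm 2 (fun x => b i x - b₀ x)) l (𝓝 0))
    (tw : Tendsto (fun i => nrm 2 (fun x => w i x - w₀ x)) l (𝓝 0)) :
    Tendsto (fun i => tri K (a i) (b i) (w i)) l (𝓝 (tri K a₀ b₀ w₀)) := by
  obtain ⟨c, hc0, hc⟩ := hK.exists_abs_tri_le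
  have hle : ∀ f f₀ : Torus L n → ℝ, MemLp f 2 volume → MemLp f₀ 2 volume →
      nrm 2 f ≤ nrm 2 f₀ + nrm 2 (fun x => f x - f₀ x) := by
    intro f f₀ hf hf₀
    have h : MemLp (fun x => f x - f₀ x) 2 volume := hf.sub hf₀
    have := nrm_add_le one_le_two hf₀ h
    simpa only [add_sub_cancel] using this
  rw [tendsto_iff_norm_sub_tendsto_zero]
  have hlim : Tendsto (fun i =>
      c * (nrm 2 (fun x => a i x - a₀ x) * (nrm 2 b₀ + nrm 2 (fun x => b i x - b₀ x))
        * (nrm 2 w₀ + nrm 2 (fun x => w i x - w₀ x)))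
      + c * (nrm 2 a₀ * nrm 2 (fun x => b i x - b₀ x) * (nrm 2 w₀ + nrm 2 (fun x => w i x - w₀ x)))
      + c * (nrm 2 a₀ * nrm 2 b₀ * nrm 2 (fun x => w i x - w₀ x))) l (𝓝 0) := by
    have := (((ta.mul (tb.const_add (nrm 2 b₀))).mul (tw.const_add (nrm 2 w₀))).const_mul c).add
      (((tb.const_mul (nrm 2 a₀)).mul (tw.const_add (nrm 2 w₀))).const_mul c) |>.add
      ((tw.const_mul (nrm 2 a₀ * nrm 2 b₀)).const_mul c)
    simpa using this
  refine squeeze_zero' (Eventually.of_forall fun i => norm_nonneg _) ?_ hlim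
  filter_upwards [ha, hb, hw] with i hai hbi hwi
  rw [hK.tri_sub_tri hai hbi hwi ha₀ hb₀ hw₀]
  refine (norm_add₃_le).trans ?_
  have n1 := nrm_nonneg 2 (fun x => a i x - a₀ x)
  have n2 := nrm_nonneg 2 (fun x => b i x - b₀ x)
  have n3 := nrm_nonneg 2 (fun x => w i x - w₀ x)
  have n4 := nrm_nonneg 2 a₀
  have n5 := nrm_nonneg 2 b₀
  have n6 := nrm_nonneg 2 w₀
  have n7 := nrm_nonneg 2 (w i)
  have lb := hle _ _ hbi hb₀
  have lw := hle _ _ hwi hw₀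
  refine add_le_add (add_le_add ?_ ?_) ?_
  · refine (hc _ _ _ (hai.sub ha₀) hbi hwi).trans ?_
    refine mul_le_mul_of_nonneg_left ?_ hc0
    exact mul_le_mul (mul_le_mul_of_nonneg_left lb n1) lw n7 (by positivity)
  · refine (hc _ _ _ ha₀ (hbi.sub hb₀) hwi).trans ?_
    refine mul_le_mul_of_nonneg_left ?_ hc0
    exact mul_le_mul_of_nonneg_left lw (mul_nonneg n4 n2)
  · exact hc _ _ _ ha₀ hb₀ (hwi.sub hw₀)

/-- Functions of time that are continuous on `S` with values in `L²`. -/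
structure ContL2On (S : Set ℝ) (w : ℝ → Torus L n → ℝ) : Prop where
  memLp : ∀ t ∈ S, MemLp (w t) 2 volume
  tendsto : ∀ t₀ ∈ S, Tendsto (fun t => nrm 2 (fun x => w t x - w t₀ x)) (𝓝[S] t₀) (𝓝 0)

theorem ContL2On.one (S : Set ℝ) : ContL2On S (fun _ (_ : Torus L n) => (1 : ℝ)) where
  memLp _ _ := memLp_const 1
  tendsto t₀ _ := by simpa [nrm] using tendsto_const_nhds

theorem IsKernel.continuousOn_tri (hK : IsKernel L K) {S : Set ℝ} {a b w : ℝ → Torus L n → ℝ}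
    (ha : ContL2On S a) (hb : ContL2On S b) (hw : ContL2On S w) :
    ContinuousOn (fun p : ℝ × ℝ => tri K (a p.1) (b p.1) (w p.2)) (S ×ˢ S) := by
  rintro ⟨t, q⟩ ⟨ht, hq⟩
  have h1 : Tendsto Prod.fst (𝓝[S ×ˢ S] (t, q)) (𝓝[S] t) := by
    rw [nhdsWithin_prod_eq]; exact tendsto_fst
  have h2 : Tendsto Prod.snd (𝓝[S ×ˢ S] (t, q)) (𝓝[S] q) := by
    rw [nhdsWithin_prod_eq]; exact tendsto_snd
  have hm : ∀ {c : ℝ → Torus L n → ℝ} {r : ℝ}, ContL2On S c → ∀ᶠ t in 𝓝[S] r,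
      MemLp (c t) 2 volume := fun hc => eventually_mem_nhdsWithin.mono fun t ht => hc.memLp t ht
  exact hK.tendsto_tri (h1.eventually (hm ha)) (h1.eventually (hm hb)) (h2.eventually (hm hw))
    (ha.memLp t ht) (hb.memLp t ht) (hw.memLp q hq) ((ha.tendsto t ht).comp h1)
    ((hb.tendsto t ht).comp h1) ((hw.tendsto q hq).comp h2)

theorem grad_sub_ae {f g : Torus L n → Vec n} (hf : MemH1 f) (hg : MemH1 g) (k i : Fin n) :
    grad (fun x => f x - g x) k i =ᵐ[volume] fun x => grad f k i x - grad g k i x := by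
  have hm : ∀ k i, MemLp (fun x => grad f k i x - grad g k i x) 2 volume := fun k i =>
    (hf.memLp_grad k i).sub (hg.memLp_grad k i)
  have hi : ∀ {w : Torus L n → ℝ} {ψ : Torus L n → ℝ}, MemLp w 2 volume → Continuous ψ →
      Integrable (fun x => w x * ψ x) volume := by
    intro w ψ hw hψ
    obtain ⟨c, hc⟩ := isCompact_univ.exists_bound_of_continuousOn hψ.continuousOn
    exact (hw.integrable (by norm_num)).mul_bdd hψ.aestronglyMeasurable
      (Eventually.of_forall fun x => hc x (mem_univ x))
  have hw : ∀ k i, IsWeakPartial k (fun x => (f x - g x) i)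
      (fun x => grad f k i x - grad g k i x) := by
    intro k i ψ hψ
    have h1 := hf.isWeakPartial_grad k i ψ hψ
    have h2 := hg.isWeakPartial_grad k i ψ hψ
    have hd : Continuous (pderiv k ψ) := by
      refine isOpenQuotientMap_proj.isQuotientMap.continuous_iff.2 ?_
      have e : pderiv k ψ ∘ proj L = fun y => fderiv ℝ (fun y : Vec n => ψ (proj L y)) y
          (EuclideanSpace.single k 1) := by
        ext y
        have h3 := (hψ.differentiable (by simp)).differentiableAt (x := y)
        have hline : HasDerivAt (fun r : ℝ => y + r • (EuclideanSpace.single k 1 : Vec n))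
            (EuclideanSpace.single k 1) 0 := by
          simpa using ((hasDerivAt_id (0 : ℝ)).smul_const
            (EuclideanSpace.single k 1 : Vec n)).const_add y
        have h4 := (HasFDerivAt.comp_hasDerivAt_of_eq (0 : ℝ) h3.hasFDerivAt hline
          (by simp)).deriv
        rw [← h4]
        simp only [Function.comp_def, proj_add, proj_smul_single]
        rfl
      rw [e]
      exact (hψ.continuous_fderiv (by simp)).clm_apply continuous_const
    simp only [PiLp.sub_apply, sub_mul]
    rw [integral_sub (hi (memLp_apply hf.1 i) hd) (hi (memLp_apply hg.1 i) hd),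
      integral_sub (hi (hf.memLp_grad k i) hψ.continuous) (hi (hg.memLp_grad k i) hψ.continuous),
      h1, h2]
    ring
  have hH : MemH1 fun x => f x - g x := ⟨hf.1.sub hg.1, fun k i => ⟨_, hm k i, hw k i⟩⟩
  exact (hH.isWeakPartial_grad k i).ae_eq (hw k i) (hH.memLp_grad k i) (hm k i)

theorem IsContinuousH1.contL2On {T : ℝ} {u : ℝ → Torus L n → Vec n} (h : IsContinuousH1 T u)
    (i : Fin n) : ContL2On (Ico 0 T) fun t x => u t x i where
  memLp t ht := memLp_apply (h.1 t ht).1 i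
  tendsto t₀ ht₀ := by
    have h1 := h.2 t₀ ht₀
    have h2 : Tendsto (fun t => eLpNorm (fun x => u t x i - u t₀ x i) 2 volume)
        (𝓝[Ico 0 T] t₀) (𝓝 0) := by
      refine tendsto_of_tendsto_of_tendsto_of_le_of_le tendsto_const_nhds h1
        (fun t => zero_le) fun t => ?_
      exact (eLpNorm_apply_le (fun x => u t x - u t₀ x) i 2).trans le_self_add
    exact (ENNReal.tendsto_toReal ENNReal.zero_ne_top).comp h2

theorem IsContinuousH1.contL2On_grad {T : ℝ} {u : ℝ → Torus L n → Vec n}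
    (h : IsContinuousH1 T u) (k i : Fin n) : ContL2On (Ico 0 T) fun t => grad (u t) k i where
  memLp t ht := (h.1 t ht).memLp_grad k i
  tendsto t₀ ht₀ := by
    have h1 := h.2 t₀ ht₀
    have h2 : Tendsto (fun t => eLpNorm (fun x => grad (u t) k i x - grad (u t₀) k i x) 2 volume)
        (𝓝[Ico 0 T] t₀) (𝓝 0) := by
      refine tendsto_of_tendsto_of_tendsto_of_le_of_le' tendsto_const_nhds h1
        (Eventually.of_forall fun t => zero_le) ?_
      filter_upwards [self_mem_nhdsWithin] with t ht
      rw [← eLpNorm_congr_ae (grad_sub_ae (h.1 t ht) (h.1 t₀ ht₀) k i)]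
      refine le_trans ?_ le_add_self
      refine le_trans ?_ (Finset.single_le_sum (f := fun k =>
        ∑ i, eLpNorm (grad (fun x => u t x - u t₀ x) k i) 2 volume)
        (fun _ _ => zero_le) (Finset.mem_univ k))
      exact Finset.single_le_sum (f := fun i =>
        eLpNorm (grad (fun x => u t x - u t₀ x) k i) 2 volume)
        (fun _ _ => zero_le) (Finset.mem_univ i)
    exact (ENNReal.tendsto_toReal ENNReal.zero_ne_top).comp h2

end LTwo

/-! ### Weak derivatives in time -/

section Time

theorem integral_Ioo_eq_intervalIntegral {T a b : ℝ} (ha : 0 < a) (hab : a ≤ b) (hb : b < T)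
    {F : ℝ → ℝ} (hF : ∀ t, t ∉ Icc a b → F t = 0) : ∫ t in Ioo 0 T, F t = ∫ t in a..b, F t := by
  rw [intervalIntegral.integral_of_le hab, ← integral_Icc_eq_integral_Ioc]
  exact (setIntegral_eq_of_subset_of_forall_sdiff_eq_zero measurableSet_Ioo
    (fun t ht => ⟨ha.trans_le ht.1, ht.2.trans_lt hb⟩) fun t ht => hF t ht.2)

/-- If the pairing of `D` with every test function of mean zero vanishes, `D` is constant. -/
theorem eqOn_const_of_integral_mul_eq_zero {T : ℝ} (hT : 0 < T) {D : ℝ → ℝ}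
    (hD : ContinuousOn D (Ioo 0 T))
    (h : ∀ ζ : ℝ → ℝ, ContDiff ℝ ∞ ζ → (∃ a b, 0 < a ∧ b < T ∧ ∀ t, t ∉ Icc a b → ζ t = 0) →
      ∫ t, ζ t = 0 → ∫ t in Ioo 0 T, ζ t * D t = 0) :
    ∃ c, ∀ t ∈ Ioo 0 T, D t = c := by
  let φ : ContDiffBump (T / 2) := ⟨T / 8, T / 4, by positivity, by linarith⟩
  set θ : ℝ → ℝ := φ.normed volume with hθ
  have hθs : ContDiff ℝ ∞ θ := φ.contDiff_normed
  have hθ0 : ∀ t, t ∉ Icc (T / 4) (3 * T / 4) → θ t = 0 := by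
    intro t ht
    have : t ∉ Function.support θ := by
      rw [hθ, φ.support_normed_eq, Real.ball_eq_Ioo]
      intro hm
      refine ht ⟨?_, ?_⟩
      · have := hm.1; simp only [φ] at this; linarith
      · have := hm.2; simp only [φ] at this; linarith
    exact Function.notMem_support.1 this
  have hint : ∀ (ζ : ℝ → ℝ), Continuous ζ →
      ∀ a b, 0 < a → b < T → (∀ t, t ∉ Icc a b → ζ t = 0) → Integrable ζ volume ∧
        IntegrableOn (fun t => ζ t * D t) (Ioo 0 T) := by
    intro ζ hζ a b ha hb h0
    have hsub : Icc a b ⊆ Ioo 0 T := fun t ht => ⟨ha.trans_le ht.1, ht.2.trans_lt hb⟩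
    refine ⟨hζ.integrable_of_hasCompactSupport (HasCompactSupport.intro isCompact_Icc h0), ?_⟩
    have h1 : IntegrableOn (fun t => ζ t * D t) (Icc a b) :=
      (hζ.continuousOn.mul (hD.mono hsub)).integrableOn_Icc
    exact h1.of_forall_sdiff_eq_zero measurableSet_Ioo fun t ht => by rw [h0 t ht.2, zero_mul]
  have hθi := hint θ hθs.continuous _ _ (by positivity) (by linarith) hθ0
  set c := ∫ t in Ioo 0 T, θ t * D t with hc
  refine ⟨c, ?_⟩
  have hDc : ContinuousOn (fun t => D t - c) (Ioo 0 T) := hD.sub continuousOn_const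
  have key : ∀ᵐ t ∂(volume : Measure ℝ), t ∈ Ioo 0 T → D t - c = 0 := by
    refine isOpen_Ioo.ae_eq_zero_of_integral_contDiff_smul_eq_zero
      (hDc.locallyIntegrableOn measurableSet_Ioo) fun ζ hζ hζc hζs => ?_
    obtain ⟨a, b, ha, hb, h0⟩ : ∃ a b, 0 < a ∧ b < T ∧ ∀ t, t ∉ Icc a b → ζ t = 0 := by
      rcases (tsupport ζ).eq_empty_or_nonempty with he | hne
      · exact ⟨T / 2, T / 2, by positivity, by linarith, fun t _ =>
          image_eq_zero_of_notMem_tsupport (by rw [he]; exact notMem_empty t)⟩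
      · obtain ⟨a, ha, ha'⟩ := hζc.isCompact.exists_isLeast hne
        obtain ⟨b, hb, hb'⟩ := hζc.isCompact.exists_isGreatest hne
        exact ⟨a, b, (hζs ha).1, (hζs hb).2, fun t ht =>
          image_eq_zero_of_notMem_tsupport fun hm => ht ⟨ha' hm, hb' hm⟩⟩
    have hζi := hint ζ hζ.continuous a b ha hb h0
    have h0' : ∀ t, t ∉ Ioo 0 T → ζ t = 0 := fun t ht =>
      h0 t fun hm => ht ⟨ha.trans_le hm.1, hm.2.trans_lt hb⟩
    have h2 := h (fun t => ζ t - (∫ t, ζ t) * θ t) (hζ.sub (contDiff_const.mul hθs))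
      ⟨min a (T / 4), max b (3 * T / 4), lt_min ha (by positivity), max_lt hb (by linarith),
        fun t ht => by
          rw [h0 t fun hm => ht ⟨(min_le_left _ _).trans hm.1, hm.2.trans (le_max_left _ _)⟩,
            hθ0 t fun hm => ht ⟨(min_le_right _ _).trans hm.1, hm.2.trans (le_max_right _ _)⟩]
          simp⟩ (by
          rw [integral_sub hζi.1 (hθi.1.const_mul _), integral_const_mul, hθ, φ.integral_normed]
          ring)
    have e1 : ∫ t in Ioo 0 T, (ζ t - (∫ t, ζ t) * θ t) * D t
        = (∫ t in Ioo 0 T, ζ t * D t) - (∫ t, ζ t) * c := by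
      rw [hc, ← integral_const_mul, ← integral_sub hζi.2 (hθi.2.const_mul _)]
      congr 1; ext t; ring
    have e2 : ∫ t in Ioo 0 T, ζ t = ∫ t, ζ t :=
      setIntegral_eq_integral_of_forall_compl_eq_zero h0'
    have e3 : ∫ t, ζ t • (D t - c) = ∫ t in Ioo 0 T, ζ t • (D t - c) :=
      (setIntegral_eq_integral_of_forall_compl_eq_zero fun t ht => by
        rw [h0' t ht, zero_smul]).symm
    rw [e3]
    simp only [smul_eq_mul, mul_sub]
    rw [integral_sub hζi.2 (hζi.1.integrableOn.mul_const c), integral_mul_const, e2]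
    linarith
  have h3 : (fun t => D t - c) =ᵐ[volume.restrict (Ioo 0 T)] fun _ => 0 :=
    (ae_restrict_iff' measurableSet_Ioo).2 key
  have h4 := Measure.eqOn_open_of_ae_eq h3 isOpen_Ioo hDc continuousOn_const
  intro t ht
  have := h4 ht
  simp only at this
  linarith

/-- The lemma of du Bois-Reymond: a continuous function with continuous weak derivative is
classically differentiable. -/
theorem hasDerivAt_of_weak {T : ℝ} (hT : 0 < T) {F N : ℝ → ℝ} (hF : ContinuousOn F (Ioo 0 T))
    (hN : ContinuousOn N (Ioo 0 T))
    (h : ∀ η : ℝ → ℝ, ContDiff ℝ ∞ η → (∃ a b, 0 < a ∧ b < T ∧ ∀ t, t ∉ Icc a b → η t = 0) →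
      ∫ t in Ioo 0 T, (deriv η t * F t + η t * N t) = 0) :
    ∀ t ∈ Ioo 0 T, HasDerivAt F (N t) t := by
  have hmid : T / 2 ∈ Ioo 0 T := ⟨by positivity, by linarith⟩
  set P : ℝ → ℝ := fun t => ∫ r in (T / 2)..t, N r with hP
  have hsub : ∀ t ∈ Ioo 0 T, uIcc (T / 2) t ⊆ Ioo 0 T := fun t ht =>
    (ordConnected_Ioo.uIcc_subset hmid ht)
  have hPd : ∀ t ∈ Ioo 0 T, HasDerivAt P (N t) t := fun t ht =>
    intervalIntegral.integral_hasDerivAt_right ((hN.mono (hsub t ht)).intervalIntegrable)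
      (hN.stronglyMeasurableAtFilter isOpen_Ioo t ht) (hN.continuousAt (isOpen_Ioo.mem_nhds ht))
  have hPc : ContinuousOn P (Ioo 0 T) := fun t ht => (hPd t ht).continuousAt.continuousWithinAt
  obtain ⟨c, hc⟩ := eqOn_const_of_integral_mul_eq_zero hT (hF.sub hPc) (by
    rintro ζ hζ ⟨a, b, ha, hb, h0⟩ hζ0
    rcases lt_or_ge b a with hba | hab
    · have : ∀ t, ζ t = 0 := fun t => h0 t (by rw [Icc_eq_empty (not_le.2 hba)]; exact notMem_empty t)
      simp [this]
    have hIcc : Icc a b ⊆ Ioo 0 T := fun t ht => ⟨ha.trans_le ht.1, ht.2.trans_lt hb⟩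
    set η : ℝ → ℝ := fun t => ∫ r in a..t, ζ r with hη
    have hηd : ∀ t, HasDerivAt η (ζ t) t := fun t =>
      intervalIntegral.integral_hasDerivAt_right (hζ.continuous.intervalIntegrable _ _)
        (hζ.continuous.stronglyMeasurableAtFilter _ _) hζ.continuous.continuousAt
    have hηd' : deriv η = ζ := funext fun t => (hηd t).deriv
    have hηs : ContDiff ℝ ∞ η := by
      rw [contDiff_infty_iff_deriv, hηd']
      exact ⟨fun t => (hηd t).differentiableAt, hζ⟩
    have hηa : ∀ t ≤ a, η t = 0 := by
      intro t ht
      rw [hη]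
      simp only
      rw [intervalIntegral.integral_symm, neg_eq_zero]
      refine (intervalIntegral.integral_congr_ae ?_).trans intervalIntegral.integral_zero
      have hne : ∀ᵐ r : ℝ, r ≠ a := by simp [ae_iff]
      filter_upwards [hne] with r hr hm
      rw [uIoc_of_le ht] at hm
      exact h0 r fun hm' => hr (le_antisymm hm.2 hm'.1)
    have hηb : ∀ t ≥ b, η t = 0 := by
      intro t ht
      have e : η t = ∫ r, ζ r := by
        rw [hη]
        simp only
        rw [intervalIntegral.integral_of_le (hab.trans ht), ← integral_Icc_eq_integral_Ioc]
        exact setIntegral_eq_integral_of_forall_compl_eq_zero fun r hr =>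
          h0 r fun hm => hr ⟨hm.1, hm.2.trans ht⟩
      rw [e, hζ0]
    have hη0 : ∀ t, t ∉ Icc a b → η t = 0 := by
      intro t ht
      rcases le_or_gt t a with h1 | h1
      · exact hηa t h1
      · exact hηb t (not_lt.1 fun h2 => ht ⟨h1.le, h2.le⟩)
    have h1 := h η hηs ⟨a, b, ha, hb, hη0⟩
    rw [hηd', integral_Ioo_eq_intervalIntegral ha hab hb
      (fun t ht => by rw [h0 t ht, hη0 t ht]; ring)] at h1
    rw [integral_Ioo_eq_intervalIntegral ha hab hb (fun t ht => by rw [h0 t ht, zero_mul])]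
    have hu : uIcc a b ⊆ Ioo 0 T := by rw [uIcc_of_le hab]; exact hIcc
    have hζc : ContinuousOn ζ (uIcc a b) := hζ.continuous.continuousOn
    have hηc : ContinuousOn η (uIcc a b) := hηs.continuous.continuousOn
    have hparts := intervalIntegral.integral_mul_deriv_eq_deriv_mul (a := a) (b := b)
      (u := η) (v := P) (u' := ζ) (v' := N) (fun t _ => hηd t) (fun t ht => hPd t (hu ht))
      hζc.intervalIntegrable (hN.mono hu).intervalIntegrable
    rw [hηa a le_rfl, hηb b le_rfl] at hparts
    have hadd := intervalIntegral.integral_add (μ := volume)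
      (hζc.mul (hF.mono hu)).intervalIntegrable (hηc.mul (hN.mono hu)).intervalIntegrable
    have hdiff := intervalIntegral.integral_sub (μ := volume)
      (hζc.mul (hF.mono hu)).intervalIntegrable (hζc.mul (hPc.mono hu)).intervalIntegrable
    simp only [Pi.mul_apply] at hadd hdiff
    rw [hadd, hparts] at h1
    simp only [Pi.sub_apply, mul_sub]
    rw [hdiff]
    linarith)
  intro t ht
  have h1 : F =ᶠ[𝓝 t] fun t => P t + c := by
    filter_upwards [isOpen_Ioo.mem_nhds ht] with r hr
    have := hc r hr
    simp only [Pi.sub_apply] at this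
    linarith
  exact ((hPd t ht).add_const c).congr_of_eventuallyEq h1

/-- The derivative of a symmetric function of two variables along the diagonal. -/
theorem hasDerivAt_diag {S : Set ℝ} (hS : IsOpen S) {b N : ℝ → ℝ → ℝ}
    (hsymm : ∀ t ∈ S, ∀ q ∈ S, b t q = b q t)
    (hb : ∀ q ∈ S, ∀ t ∈ S, HasDerivAt (fun t => b t q) (N t q) t)
    (hN : ContinuousOn (fun p : ℝ × ℝ => N p.1 p.2) (S ×ˢ S)) {t : ℝ} (ht : t ∈ S) :
    HasDerivAt (fun t => b t t) (2 * N t t) t := by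
  rw [hasDerivAt_iff_isLittleO, Asymptotics.isLittleO_iff]
  intro c hc
  have hcont := (hN.continuousAt ((hS.prod hS).mem_nhds (mk_mem_prod ht ht)))
  obtain ⟨δ₁, hδ₁, H₁⟩ := Metric.continuousAt_iff.1 hcont (c / 2) (by positivity)
  obtain ⟨δ₂, hδ₂, H₂⟩ := Metric.isOpen_iff.1 hS t ht
  set δ := min δ₁ δ₂ with hδ
  have hδ0 : 0 < δ := lt_min hδ₁ hδ₂
  have hmem : ∀ {r}, r ∈ Metric.ball t δ → r ∈ S := fun hr =>
    H₂ (Metric.ball_subset_ball (min_le_right _ _) hr)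
  have key : ∀ q ∈ Metric.ball t δ, ∀ r ∈ Metric.ball t δ,
      |b r q - b t q - (r - t) * N t t| ≤ c / 2 * |r - t| := by
    intro q hq r hr
    have h := (convex_ball t δ).norm_image_sub_le_of_norm_hasDerivWithin_le
      (f := fun ξ => b ξ q - ξ * N t t) (f' := fun ξ => N ξ q - 1 * N t t) (C := c / 2)
      (fun ξ hξ => ((hb q (hmem hq) ξ (hmem hξ)).sub
        ((hasDerivAt_id ξ).mul_const (N t t))).hasDerivWithinAt)
      (fun ξ hξ => by
        have h3 : dist (ξ, q) (t, t) < δ₁ := by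
          rw [Prod.dist_eq]
          exact max_lt ((Metric.mem_ball.1 hξ).trans_le (min_le_left _ _))
            ((Metric.mem_ball.1 hq).trans_le (min_le_left _ _))
        have h4 := (H₁ h3).le
        rw [Real.dist_eq] at h4
        rw [one_mul]
        exact h4) (Metric.mem_ball_self hδ0) hr
    rw [Real.norm_eq_abs, Real.norm_eq_abs] at h
    refine le_trans (le_of_eq ?_) h
    congr 1; ring
  filter_upwards [Metric.ball_mem_nhds t hδ0] with r hr
  have h1 := key r hr r hr
  have h2 := key t (Metric.mem_ball_self hδ0) r hr
  have e : b r r - b t t - (r - t) • (2 * N t t)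
      = (b r r - b t r - (r - t) * N t t) + (b r t - b t t - (r - t) * N t t) := by
    rw [hsymm t ht r (hmem hr), smul_eq_mul]; ring
  rw [e, Real.norm_eq_abs, Real.norm_eq_abs]
  refine (abs_add_le _ _).trans ?_
  linarith

end Time

/-! ### The equation tested with averages of the solution -/

section Equation

variable {L : ℝ} {n : ℕ} [Fact (0 < L)]

/-- Integrability of a function together with the value of its integral. -/
def HasInt (f : Torus L n → ℝ) (c : ℝ) : Prop := Integrable f volume ∧ ∫ x, f x = c

theorem HasInt.add {f g : Torus L n → ℝ} {c d : ℝ} (hf : HasInt f c) (hg : HasInt g d) :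
    HasInt (fun x => f x + g x) (c + d) :=
  ⟨hf.1.add hg.1, by rw [integral_add hf.1 hg.1, hf.2, hg.2]⟩

theorem HasInt.sub {f g : Torus L n → ℝ} {c d : ℝ} (hf : HasInt f c) (hg : HasInt g d) :
    HasInt (fun x => f x - g x) (c - d) :=
  ⟨hf.1.sub hg.1, by rw [integral_sub hf.1 hg.1, hf.2, hg.2]⟩

theorem HasInt.const_mul {f : Torus L n → ℝ} {c : ℝ} (hf : HasInt f c) (r : ℝ) :
    HasInt (fun x => r * f x) (r * c) :=
  ⟨hf.1.const_mul r, by rw [integral_const_mul, hf.2]⟩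

theorem HasInt.sum {ι : Type*} [Fintype ι] {f : ι → Torus L n → ℝ} {c : ι → ℝ}
    (hf : ∀ i, HasInt (f i) (c i)) : HasInt (fun x => ∑ i, f i x) (∑ i, c i) :=
  ⟨integrable_finsetSum _ fun i _ => (hf i).1, by
    rw [integral_finsetSum _ fun i _ => (hf i).1]
    exact Finset.sum_congr rfl fun i _ => (hf i).2⟩

theorem IsKernel.hasInt_tri {K : Vec n → ℝ} (hK : IsKernel L K) {a b w : Torus L n → ℝ}
    (ha : MemLp a 2 volume) (hb : MemLp b 2 volume) (hw : MemLp w 2 volume) :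
    HasInt (fun x => a x * b x * avg K w x) (tri K a b w) :=
  ⟨hK.integrable_tri ha hb (hw.integrable (by norm_num)), rfl⟩

/-- The regularized energy, polarized: the energy form at `f` and an average of `f'`. -/
def energy (α : ℝ) (ρ : Vec n → ℝ) (f f' : Torus L n → Vec n) : ℝ :=
  (∑ l, tri ρ (fun x => f x l) (fun _ => 1) (fun x => f' x l))
    + α ^ 2 * ∑ k, ∑ l, tri ρ (grad f k l) (fun _ => 1) (grad f' k l)

/-- The average of a vector field. -/
def avgVec (ρ : Vec n → ℝ) (f : Torus L n → Vec n) (x : Torus L n) : Vec n :=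
  WithLp.toLp 2 fun l => avg ρ (fun y => f y l) x

omit [Fact (0 < L)] in
theorem pderiv_const_mul (k : Fin n) (c : ℝ) (f : Torus L n → ℝ) :
    pderiv k (fun y => c * f y) = fun x => c * pderiv k f x := by
  ext x
  simp only [pderiv]
  exact deriv_const_mul_field c

variable {C δ : ℝ} {ρ : Vec n → ℝ}

theorem MemH1.integrable {f : Torus L n → Vec n} (hf : MemH1 f) (i : Fin n) :
    Integrable (fun x => f x i) volume := (memLp_apply hf.1 i).integrable (by norm_num)

theorem MemH1.integrable_grad {f : Torus L n → Vec n} (hf : MemH1 f) (k i : Fin n) :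
    Integrable (grad f k i) volume := (hf.memLp_grad k i).integrable (by norm_num)

theorem IsMollifier.isTestField (hρ : IsMollifier L C δ ρ) {T : ℝ} {f : Torus L n → Vec n}
    (hf : MemH1 f) (hdiv : IsWeaklyDivFree f) {η : ℝ → ℝ} (hη : ContDiff ℝ ∞ η)
    (hη0 : ∃ a b, 0 < a ∧ b < T ∧ ∀ t, t ∉ Icc a b → η t = 0) :
    IsTestField T fun t x => η t • avgVec ρ f x where
  smooth := by
    refine (hη.comp contDiff_fst).smul ?_
    rw [contDiff_euclidean]
    intro i
    exact (hρ.isKernel.contDiff_avg hρ.contDiff (hf.integrable i)).comp contDiff_snd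
  compact_support := by
    obtain ⟨a, b, ha, hb, h0⟩ := hη0
    exact ⟨a, b, ha, hb, fun t ht x => by rw [h0 t ht, zero_smul]⟩
  div_free t x := by
    have e : ∀ i, pderiv i (fun y => (η t • avgVec ρ f y) i) x
        = η t * pderiv i (avg ρ fun y => f y i) x := fun i =>
      congrFun (pderiv_const_mul i (η t) (avg ρ fun y => f y i)) x
    simp only [e, ← Finset.mul_sum]
    have h := hρ.isKernel.sum_avg_dker hρ.contDiff hf.integrable hdiv x
    simp only [fun i => hρ.isKernel.pderiv_avg hρ.contDiff (hf.integrable i) i,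
      Finset.sum_neg_distrib, h, neg_zero, mul_zero]

/-- For a test field `η(t) ρ * f'` the space integral in the weak formulation splits into the
energy and the flux. -/
theorem IsMollifier.weakIntegral_eq (hρ : IsMollifier L C δ ρ) (α : ℝ)
    {f f' : Torus L n → Vec n} (hf : MemH1 f) (hf' : MemH1 f') (c c' : ℝ) :
    weakIntegral α f (fun x => c • avgVec ρ f' x) (fun x => c' • avgVec ρ f' x)
      = c' * energy α ρ f f' + c * flux α ρ (fun i x => f x i) (grad f) (grad f') := by
  have hk := hρ.isKernel
  have hp : ∀ r k l, pderiv k (fun y => (r • avgVec ρ f' y) l)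
      = fun x => r * avg ρ (grad f' k l) x := by
    intro r k l
    have e := pderiv_const_mul k r (avg ρ fun y => f' y l)
    rw [hk.pderiv_avg_of_isWeakPartial hρ.contDiff (hf'.integrable l) (hf'.integrable_grad k l)
      (hf'.isWeakPartial_grad k l)] at e
    exact e
  have hpp : ∀ r k j l, pderiv k (pderiv j (fun y => (r • avgVec ρ f' y) l))
      = fun x => r * -avg (dker k ρ) (grad f' j l) x := by
    intro r k j l
    rw [hp, pderiv_const_mul, hk.pderiv_avg hρ.contDiff (hf'.integrable_grad j l)]
  have mf := memLp_apply hf.1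
  have mf' := memLp_apply hf'.1
  have mg := hf.memLp_grad
  have mg' := hf'.memLp_grad
  have m1 : MemLp (fun _ : Torus L n => (1 : ℝ)) 2 volume := memLp_const 1
  have h1 : HasInt _ (energy α ρ f f') :=
    (HasInt.sum fun l => hk.hasInt_tri (mf l) m1 (mf' l)).add
      ((HasInt.sum fun k => HasInt.sum fun l =>
        hk.hasInt_tri (mg k l) m1 (mg' k l)).const_mul (α ^ 2))
  have h2 : HasInt _ (flux α ρ (fun i x => f x i) (grad f) (grad f')) :=
    (HasInt.sum fun k => HasInt.sum fun l =>
      ((hk.hasInt_tri (mf k) (mf l) (mg' k l)).sub ((HasInt.sum fun j =>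
        hk.hasInt_tri (mg k j) (mg l j) (mg' k l)).const_mul (α ^ 2))).add ((HasInt.sum fun j =>
        hk.hasInt_tri (mg j k) (mg j l) (mg' k l)).const_mul (α ^ 2))).sub
    ((HasInt.sum fun k => HasInt.sum fun j => HasInt.sum fun l =>
      (hρ.isKernel_dker k).hasInt_tri (mf k) (mg j l) (mg' j l)).const_mul (α ^ 2))
  have h3 := (h1.const_mul c').add (h2.const_mul c)
  rw [weakIntegral, ← h3.2]
  refine integral_congr_ae (Eventually.of_forall fun x => ?_)
  simp only [hpp]
  simp only [hp]
  have ev : ∀ r l, (r • avgVec ρ f' x) l = r * avg ρ (fun y => f' y l) x := fun r l => rfl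
  simp only [ev, mul_add, Finset.mul_sum, Finset.sum_add_distrib, sub_eq_add_neg,
    ← Finset.sum_neg_distrib, add_assoc]
  refine congrArg₂ _ (Finset.sum_congr rfl fun l _ => by ring) (congrArg₂ _
    (Finset.sum_congr rfl fun k _ => Finset.sum_congr rfl fun l _ => by ring) (congrArg₂ _
    (Finset.sum_congr rfl fun k _ => Finset.sum_congr rfl fun l _ => by ring) (congrArg₂ _
    (Finset.sum_congr rfl fun k _ => Finset.sum_congr rfl fun l _ =>
      Finset.sum_congr rfl fun j _ => by ring) (congrArg₂ _
    (Finset.sum_congr rfl fun k _ => Finset.sum_congr rfl fun l _ =>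
      Finset.sum_congr rfl fun j _ => by ring)
    (Finset.sum_congr rfl fun k _ => Finset.sum_congr rfl fun l _ =>
      Finset.sum_congr rfl fun j _ => by ring)))))

theorem IsMollifier.energy_comm (hρ : IsMollifier L C δ ρ) (α : ℝ) {f f' : Torus L n → Vec n}
    (hf : MemH1 f) (hf' : MemH1 f') : energy α ρ f f' = energy α ρ f' f := by
  have e : ∀ a b : Torus L n → ℝ, Integrable a volume → Integrable b volume →
      tri ρ a (fun _ => 1) b = tri ρ b (fun _ => 1) a := by
    intro a b ha hb
    have h := hρ.isKernel.integral_mul_avg_comm ha hb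
    simp only [hρ.even] at h
    simpa only [tri, mul_one] using h
  simp only [energy, e _ _ (hf.integrable _) (hf'.integrable _),
    e _ _ (hf.integrable_grad _ _) (hf'.integrable_grad _ _)]

variable {T α : ℝ} {u : ℝ → Torus L n → Vec n}

theorem IsMollifier.continuousOn_flux (hρ : IsMollifier L C δ ρ) (hu : IsContinuousH1 T u) :
    ContinuousOn (fun p : ℝ × ℝ =>
      flux α ρ (fun i x => u p.1 x i) (grad (u p.1)) (grad (u p.2))) (Ico 0 T ×ˢ Ico 0 T) := by
  have c := hu.contL2On
  have g := hu.contL2On_grad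
  have hk := hρ.isKernel
  refine ContinuousOn.sub (continuousOn_finsetSum _ fun k _ => continuousOn_finsetSum _
    fun l _ => ((hk.continuousOn_tri (c k) (c l) (g k l)).sub (continuousOn_const.mul
      (continuousOn_finsetSum _ fun j _ => hk.continuousOn_tri (g k j) (g l j) (g k l)))).add
      (continuousOn_const.mul
      (continuousOn_finsetSum _ fun j _ => hk.continuousOn_tri (g j k) (g j l) (g k l))))
    (continuousOn_const.mul (continuousOn_finsetSum _ fun k _ => continuousOn_finsetSum _
      fun j _ => continuousOn_finsetSum _ fun l _ =>
        (hρ.isKernel_dker k).continuousOn_tri (c k) (g j l) (g j l)))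

theorem IsMollifier.continuousOn_energy (hρ : IsMollifier L C δ ρ) (hu : IsContinuousH1 T u) :
    ContinuousOn (fun p : ℝ × ℝ => energy α ρ (u p.1) (u p.2)) (Ico 0 T ×ˢ Ico 0 T) := by
  have c := hu.contL2On
  have g := hu.contL2On_grad
  have hk := hρ.isKernel
  exact (continuousOn_finsetSum _ fun l _ =>
    hk.continuousOn_tri (c l) (ContL2On.one _) (c l)).add (continuousOn_const.mul
      (continuousOn_finsetSum _ fun k _ => continuousOn_finsetSum _ fun l _ =>
        hk.continuousOn_tri (g k l) (ContL2On.one _) (g k l)))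

/-- Testing the equation with `η(t) ψ(x)`, where `ψ` is an average of the solution at time `q`. -/
theorem IsMollifier.hasDerivAt_energy_left (hρ : IsMollifier L C δ ρ) (hT : 0 < T)
    (hu : IsWeakSolution α T u) {q : ℝ} (hq : q ∈ Ioo 0 T) {t : ℝ} (ht : t ∈ Ioo 0 T) :
    HasDerivAt (fun t => energy α ρ (u t) (u q))
      (flux α ρ (fun i x => u t x i) (grad (u t)) (grad (u q))) t := by
  have hsub : Ioo 0 T ⊆ Ico 0 T := Ioo_subset_Ico_self
  have hH := fun t ht => hu.continuous_h1.1 t (hsub ht)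
  have hpair : ContinuousOn (fun t : ℝ => (t, q)) (Ioo 0 T) := by fun_prop
  have hmaps : MapsTo (fun t : ℝ => (t, q)) (Ioo 0 T) (Ico 0 T ×ˢ Ico 0 T) :=
    fun t ht => ⟨hsub ht, hsub hq⟩
  have hfl : ContinuousOn (fun t => flux α ρ (fun i x => u t x i) (grad (u t)) (grad (u q)))
      (Ioo 0 T) := by
    have h := (hρ.continuousOn_flux (α := α) hu.continuous_h1).comp hpair hmaps
    exact h
  have hen : ContinuousOn (fun t => energy α ρ (u t) (u q)) (Ioo 0 T) := by
    have h := (hρ.continuousOn_energy (α := α) hu.continuous_h1).comp hpair hmaps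
    exact h
  refine hasDerivAt_of_weak hT hen hfl (fun η hη hη0 => ?_) t ht
  refine Eq.trans ?_
    (hu.equation _ (hρ.isTestField (hH q hq) (hu.div_free q (hsub hq)) hη hη0))
  refine setIntegral_congr_fun measurableSet_Ioo fun t ht => ?_
  have e : (fun x => deriv (fun r => η r • avgVec ρ (u q) x) t)
      = fun x => deriv η t • avgVec ρ (u q) x := by
    ext1 x
    exact deriv_smul_const ((hη.differentiable (by simp)) t) _
  simp only
  rw [e, hρ.weakIntegral_eq α (hH t ht) (hH q hq)]

/-- The regularized energy balance. No regularization in time is needed: freezing one argument of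
the symmetric energy form leaves a test field of the form `η(t) ψ(x)`. -/
theorem IsMollifier.hasDerivAt_energy (hρ : IsMollifier L C δ ρ) (hT : 0 < T)
    (hu : IsWeakSolution α T u) {t : ℝ} (ht : t ∈ Ioo 0 T) :
    HasDerivAt (fun t => energy α ρ (u t) (u t))
      (2 * flux α ρ (fun i x => u t x i) (grad (u t)) (grad (u t))) t := by
  have hsub : Ioo 0 T ⊆ Ico 0 T := Ioo_subset_Ico_self
  have hH := fun t ht => hu.continuous_h1.1 t (hsub ht)
  have hfl := (hρ.continuousOn_flux (α := α) hu.continuous_h1).mono (prod_mono hsub hsub)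
  exact hasDerivAt_diag (b := fun t q => energy α ρ (u t) (u q))
    (N := fun t q => flux α ρ (fun i x => u t x i) (grad (u t)) (grad (u q))) isOpen_Ioo
    (fun t ht q hq => hρ.energy_comm α (hH t ht) (hH q hq))
    (fun q hq t ht => hρ.hasDerivAt_energy_left hT hu hq ht) hfl ht

end Equation

/-! ### Measurability in time of the Besov norm -/

section Measurability

variable {L : ℝ} {n : ℕ}

theorem fwdDiff_iterate_sub {E : Type*} [AddCommGroup E] (a : Torus L n) (f g : Torus L n → E)
    (r : ℕ) : (fwdDiff a)^[r] (fun x => f x - g x) = (fwdDiff a)^[r] f - (fwdDiff a)^[r] g := by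
  induction r generalizing f g with
  | zero => rfl
  | succ r ih =>
    simp only [Function.iterate_succ_apply]
    rw [← ih]
    congr 1
    ext x
    simp only [fwdDiff]
    abel

variable [Fact (0 < L)]

theorem eLpNorm_fwdDiff_iterate_le {E : Type*} [NormedAddCommGroup E] {p : ℝ≥0∞} (hp : 1 ≤ p)
    {f : Torus L n → E} (hf : MemLp f p volume) (a : Torus L n) (r : ℕ) :
    eLpNorm ((fwdDiff a)^[r] f) p volume ≤ 2 ^ r * eLpNorm f p volume := by
  induction r with
  | zero => simp
  | succ r ih =>
    rw [Function.iterate_succ_apply']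
    have h := memLp_fwdDiff_iterate hf a r
    have h2 := eLpNorm_sub_le (memLp_translate h a).1 h.1 hp
    rw [eLpNorm_translate h.1] at h2
    calc _ ≤ _ := h2
      _ ≤ 2 ^ r * eLpNorm f p volume + 2 ^ r * eLpNorm f p volume := add_le_add ih ih
      _ = 2 ^ (r + 1) * eLpNorm f p volume := by rw [pow_succ]; ring

/-- An `Lᵖ` norm is lower semicontinuous along a curve that is continuous in `L^q`, since a sequence
that converges in `L^q` has a subsequence that converges almost everywhere. -/
theorem lowerSemicontinuous_eLpNorm {X E : Type*} [TopologicalSpace X]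
    [FirstCountableTopology X] [NormedAddCommGroup E] {w : X → Torus L n → E} {p q : ℝ≥0∞}
    (hq0 : q ≠ 0) (hq : q ≠ ⊤)
    (hm : ∀ t, AEStronglyMeasurable (w t) volume)
    (hw : ∀ t₀, Tendsto (fun t => eLpNorm (w t - w t₀) q volume) (𝓝 t₀) (𝓝 0)) :
    LowerSemicontinuous fun t => eLpNorm (w t) p volume := by
  intro t₀ y hy
  by_contra hcon
  have hfreq : ∃ᶠ t in 𝓝 t₀, eLpNorm (w t) p volume ≤ y := by
    simpa only [Filter.Frequently, not_le] using hcon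
  have hne : NeBot (𝓝 t₀ ⊓ 𝓟 {t | eLpNorm (w t) p volume ≤ y}) :=
    frequently_mem_iff_neBot.1 hfreq
  have h1 : TendstoInMeasure volume w (𝓝 t₀ ⊓ 𝓟 {t | eLpNorm (w t) p volume ≤ y}) (w t₀) :=
    tendstoInMeasure_of_tendsto_eLpNorm_of_ne_top hq0 hq hm (hm t₀)
      ((hw t₀).mono_left inf_le_left)
  have h2 := eLpNorm_le_of_tendstoInMeasure (p := p) (C := y)
    (mem_inf_of_right (mem_principal_self _)) h1 hm
  exact absurd hy (not_lt.2 h2)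

theorem IsContinuousH1.aemeasurable_besovNorm {T : ℝ} {u : ℝ → Torus L n → Vec n}
    (hu : IsContinuousH1 T u) (s : ℝ) (p : ℝ≥0∞) :
    AEMeasurable (fun t => besovNorm s p (u t)) (volume.restrict (Ico 0 T)) := by
  have hlim : ∀ t₀ : Ico (0 : ℝ) T, Tendsto (fun t : Ico (0 : ℝ) T =>
      eLpNorm (fun x => u t x - u t₀ x) 2 volume) (𝓝 t₀) (𝓝 0) := by
    intro t₀
    have h1 : Tendsto (fun t : Ico (0 : ℝ) T => h1Norm (fun x => u t x - u t₀ x)) (𝓝 t₀) (𝓝 0) := by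
      have := hu.2 t₀ t₀.2
      rw [nhdsWithin_eq_map_subtype_coe t₀.2, tendsto_map'_iff] at this
      exact this
    exact tendsto_of_tendsto_of_tendsto_of_le_of_le tendsto_const_nhds h1
      (fun t => zero_le) fun t => le_self_add
  have hl0 : LowerSemicontinuous fun t : Ico (0 : ℝ) T => eLpNorm (u t) p volume :=
    lowerSemicontinuous_eLpNorm two_ne_zero ENNReal.ofNat_ne_top (fun t => (hu.1 t t.2).1.1) hlim
  have hlh : ∀ (a : Torus L n) (r : ℕ), LowerSemicontinuous fun t : Ico (0 : ℝ) T =>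
      eLpNorm ((fwdDiff a)^[r] (u t)) p volume := by
    intro a r
    refine lowerSemicontinuous_eLpNorm two_ne_zero ENNReal.ofNat_ne_top
      (fun t => (memLp_fwdDiff_iterate (hu.1 t t.2).1 a r).1) fun t₀ => ?_
    have h2 : Tendsto (fun t : Ico (0 : ℝ) T =>
        2 ^ r * eLpNorm (fun x => u t x - u t₀ x) 2 volume) (𝓝 t₀) (𝓝 0) := by
      have := ENNReal.Tendsto.const_mul (a := 2 ^ r) (hlim t₀)
        (Or.inr (ENNReal.pow_ne_top ENNReal.ofNat_ne_top))
      rwa [mul_zero] at this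
    refine tendsto_of_tendsto_of_tendsto_of_le_of_le tendsto_const_nhds h2
      (fun t => zero_le) fun t => ?_
    rw [← fwdDiff_iterate_sub]
    exact eLpNorm_fwdDiff_iterate_le one_le_two ((hu.1 t t.2).1.sub (hu.1 t₀ t₀.2).1) a r
  have hl : LowerSemicontinuous fun t : Ico (0 : ℝ) T => besovNorm s p (u t) := by
    refine hl0.add (lowerSemicontinuous_biSup fun h hh => ?_)
    simp only [div_eq_mul_inv]
    refine Continuous.comp_lowerSemicontinuous
      (g := fun y => y * (ENNReal.ofReal (‖h‖ ^ s))⁻¹)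
      (ENNReal.continuous_mul_const (ENNReal.inv_ne_top.2 ?_)) (hlh _ _)
      fun a b hab => mul_le_mul_left hab _
    have : 0 < ‖h‖ := norm_pos_iff.2 hh
    simpa using Real.rpow_pos_of_pos this s
  rw [← map_comap_subtype_coe measurableSet_Ico,
    (MeasurableEmbedding.subtype_coe measurableSet_Ico).aemeasurable_map_iff]
  exact hl.measurable.aemeasurable

end Measurability

/-! ### Conservation of energy -/

section Conservation

variable {L : ℝ} {n : ℕ} [Fact (0 < L)]

theorem MemH1.hamiltonian_eq {f : Torus L n → Vec n} (hf : MemH1 f) (α : ℝ) :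
    hamiltonian α f = (∑ l, ∫ x, f x l * f x l)
      + α ^ 2 * ∑ k, ∑ l, ∫ x, grad f k l x * grad f k l x := by
  have h1 := fun l => integrable_mul_of_memLp (memLp_apply hf.1 l) (memLp_apply hf.1 l)
  have h2 := fun k l => integrable_mul_of_memLp (hf.memLp_grad k l) (hf.memLp_grad k l)
  rw [hamiltonian]
  congr 2
  · rw [← integral_finsetSum _ fun l _ => h1 l]
    congr 1; ext x
    rw [EuclideanSpace.norm_sq_eq]
    simp only [Real.norm_eq_abs, pow_two, abs_mul_abs_self]
  · simp only [pow_two]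
    rw [integral_finsetSum _ fun k _ => integrable_finsetSum _ fun l _ => h2 k l]
    exact Finset.sum_congr rfl fun k _ => integral_finsetSum _ fun l _ => h2 k l

theorem tendsto_energy {C : ℝ} {δ : ℕ → ℝ} {ρ : ℕ → Vec n → ℝ}
    (hρ : ∀ j, IsMollifier L C (δ j) (ρ j)) (hδ : Tendsto δ atTop (𝓝 0)) (α : ℝ)
    {f : Torus L n → Vec n} (hf : MemH1 f) :
    Tendsto (fun j => energy α (ρ j) f f) atTop (𝓝 (hamiltonian α f)) := by
  rw [hf.hamiltonian_eq]
  have h : ∀ w : Torus L n → ℝ, MemLp w 2 volume →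
      Tendsto (fun j => tri (ρ j) w (fun _ => 1) w) atTop (𝓝 (∫ x, w x * w x)) := by
    intro w hw
    have := tendsto_integral_mul_avg (p := 2) (q := 2) hρ hδ hw hw
    simpa only [tri, mul_one] using this
  exact (tendsto_finsetSum _ fun l _ => h _ (memLp_apply hf.1 l)).add
    ((tendsto_finsetSum _ fun k _ => tendsto_finsetSum _ fun l _ =>
      h _ (hf.memLp_grad k l)).const_mul _)

theorem ContL2On.continuousOn_integral_sq {S : Set ℝ} {w : ℝ → Torus L n → ℝ}
    (h : ContL2On S w) : ContinuousOn (fun t => ∫ x, w t x * w t x) S := by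
  intro t₀ ht₀
  have h0 := h.memLp t₀ ht₀
  have ht := h.tendsto t₀ ht₀
  refine tendsto_iff_norm_sub_tendsto_zero.2 ?_
  have hlim : Tendsto (fun t => nrm 2 (fun x => w t x - w t₀ x)
      * (nrm 2 (fun x => w t x - w t₀ x) + (nrm 2 (w t₀) + nrm 2 (w t₀)))) (𝓝[S] t₀) (𝓝 0) := by
    have := ht.mul (ht.add_const (nrm 2 (w t₀) + nrm 2 (w t₀)))
    simpa using this
  refine squeeze_zero' (Eventually.of_forall fun t => norm_nonneg _) ?_ hlim
  filter_upwards [self_mem_nhdsWithin] with t hts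
  have h1 := h.memLp t hts
  have hd : MemLp (fun x => w t x - w t₀ x) 2 volume := h1.sub h0
  have hs : MemLp (fun x => (w t x - w t₀ x) + (w t₀ x + w t₀ x)) 2 volume := hd.add (h0.add h0)
  rw [← integral_sub (integrable_mul_of_memLp h1 h1) (integrable_mul_of_memLp h0 h0)]
  have e : ∀ x, w t x * w t x - w t₀ x * w t₀ x
      = (w t x - w t₀ x) * ((w t x - w t₀ x) + (w t₀ x + w t₀ x)) := fun x => by ring
  simp only [e]
  refine (abs_integral_mul_le hd hs).trans (mul_le_mul_of_nonneg_left ?_ (nrm_nonneg _ _))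
  exact (nrm_add_le one_le_two hd (h0.add h0)).trans
    (add_le_add le_rfl (nrm_add_le one_le_two h0 h0))

theorem IsContinuousH1.continuousOn_hamiltonian {T : ℝ} {u : ℝ → Torus L n → Vec n}
    (hu : IsContinuousH1 T u) (α : ℝ) :
    ContinuousOn (fun t => hamiltonian α (u t)) (Ico 0 T) := by
  have h : ContinuousOn (fun t => (∑ l, ∫ x, u t x l * u t x l)
      + α ^ 2 * ∑ k, ∑ l, ∫ x, grad (u t) k l x * grad (u t) k l x) (Ico 0 T) :=
    (continuousOn_finsetSum _ fun l _ => (hu.contL2On l).continuousOn_integral_sq).add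
      (continuousOn_const.mul (continuousOn_finsetSum _ fun k _ => continuousOn_finsetSum _
        fun l _ => (hu.contL2On_grad k l).continuousOn_integral_sq))
  exact h.congr fun t ht => (hu.1 t ht).hamiltonian_eq α

/-- The energy is constant on the open interval: the regularized energies change by the time
integral of the flux, which tends to zero by dominated convergence. -/
theorem hamiltonian_eq_of_mem_Ioo {α T s : ℝ} (hT : 0 < T) (hs : 1 < s)
    {u : ℝ → Torus L n → Vec n} (hu : IsWeakSolution α T u) (hB : MemL3Besov T s u) {t₁ t₂ : ℝ}
    (h₁ : 0 < t₁) (h₁₂ : t₁ ≤ t₂) (h₂ : t₂ < T) :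
    hamiltonian α (u t₁) = hamiltonian α (u t₂) := by
  obtain ⟨C, δ, ρ, hC, hρ, hδ1, hδ⟩ := exists_seq_isMollifier L n
  obtain ⟨C', hC', hreg⟩ := exists_isRegular L n hs
  have hsub : Icc t₁ t₂ ⊆ Ioo 0 T := fun t ht => ⟨h₁.trans_le ht.1, ht.2.trans_lt h₂⟩
  have hsub' : Ioc t₁ t₂ ⊆ Ico 0 T := fun t ht =>
    Ioo_subset_Ico_self (hsub (Ioc_subset_Icc_self ht))
  set fl : ℕ → ℝ → ℝ := fun j t => 2 * flux α (ρ j) (fun i x => u t x i) (grad (u t)) (grad (u t))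
    with hfl
  have hflc : ∀ j, ContinuousOn (fl j) (Icc t₁ t₂) := by
    intro j
    have h := (hρ j).continuousOn_flux (α := α) hu.continuous_h1
    have hp : ContinuousOn (fun t : ℝ => (t, t)) (Icc t₁ t₂) := by fun_prop
    have h' := h.comp hp fun t ht =>
      ⟨Ioo_subset_Ico_self (hsub ht), Ioo_subset_Ico_self (hsub ht)⟩
    exact continuousOn_const.mul h'
  have hftc : ∀ j, ∫ t in t₁..t₂, fl j t
      = energy α (ρ j) (u t₂) (u t₂) - energy α (ρ j) (u t₁) (u t₁) := by
    intro j
    refine intervalIntegral.integral_eq_sub_of_hasDerivAt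
      (f := fun t => energy α (ρ j) (u t) (u t)) (fun t ht => ?_) ?_
    · rw [uIcc_of_le h₁₂] at ht
      exact (hρ j).hasDerivAt_energy hT hu (hsub ht)
    · rw [← uIcc_of_le h₁₂] at hflc
      exact (hflc j).intervalIntegrable
  have hmeas := (hu.continuous_h1.aemeasurable_besovNorm s 3).pow_const 3
  have hfin : ∀ᵐ t ∂(volume.restrict (Ico 0 T)), besovNorm s 3 (u t) ≠ ⊤ := by
    filter_upwards [ae_lt_top' hmeas hB.ne] with t ht htop
    rw [htop] at ht
    simp at ht
  have hfin' : ∀ᵐ t ∂(volume : Measure ℝ), t ∈ uIoc t₁ t₂ → besovNorm s 3 (u t) ≠ ⊤ := by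
    filter_upwards [(ae_restrict_iff' measurableSet_Ico).1 hfin] with t ht hm
    rw [uIoc_of_le h₁₂] at hm
    exact ht (hsub' hm)
  have hregt : ∀ t ∈ uIoc t₁ t₂, besovNorm s 3 (u t) ≠ ⊤ →
      IsRegular (u t) (grad (u t)) (C' * (besovNorm s 3 (u t)).toReal) := by
    intro t ht htop
    rw [uIoc_of_le h₁₂] at ht
    exact hreg (u t) (hu.continuous_h1.1 t (hsub' ht)) (hu.div_free t (hsub' ht)) htop
  have hlim : Tendsto (fun j => ∫ t in t₁..t₂, fl j t) atTop (𝓝 (∫ t in t₁..t₂, (0 : ℝ))) := by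
    refine intervalIntegral.tendsto_integral_filter_of_dominated_convergence
      (fun t => 2 * ((n * (2 * n * C) + α ^ 2 * (n * (n * (2 * n * C)))
        + α ^ 2 * (n * (n * (n * 2)))) * C' ^ 3) * (besovNorm s 3 (u t) ^ 3).toReal)
      (Eventually.of_forall fun j => ?_) (Eventually.of_forall fun j => ?_) ?_ ?_
    · rw [uIoc_of_le h₁₂]
      exact ((hflc j).mono Ioc_subset_Icc_self).aestronglyMeasurable measurableSet_Ioc
    · filter_upwards [hfin'] with t ht hm
      have h := (hregt t hm (ht hm)).abs_flux_le hC (hρ j) (hδ1 j).2 α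
      rw [hfl, Real.norm_eq_abs, abs_mul, abs_two, ENNReal.toReal_pow]
      rw [mul_pow] at h
      linarith
    · have h := (integrable_toReal_of_lintegral_ne_top hmeas hB.ne).mono_measure
        (Measure.restrict_mono hsub' le_rfl)
      rw [intervalIntegrable_iff_integrableOn_Ioc_of_le h₁₂]
      exact Integrable.const_mul h _
    · filter_upwards [hfin'] with t ht hm
      have h := ((hregt t hm (ht hm)).tendsto_flux hC hρ (fun j => (hδ1 j).2) hδ α).const_mul 2
      rw [mul_zero] at h
      exact h
  simp only [hftc, intervalIntegral.integral_zero] at hlim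
  have hlim2 := (tendsto_energy hρ hδ α (hu.continuous_h1.1 t₂
    (Ioo_subset_Ico_self (hsub (right_mem_Icc.2 h₁₂))))).sub
    (tendsto_energy hρ hδ α (hu.continuous_h1.1 t₁
    (Ioo_subset_Ico_self (hsub (left_mem_Icc.2 h₁₂)))))
  have := tendsto_nhds_unique hlim hlim2
  linarith

end Conservation

end EulerAlpha

end

theorem lemma1p3 (L : ℝ) [Fact (0 < L)] (n : ℕ) (hn : n = 2 ∨ n = 3)
    (α : ℝ) (hα : 0 < α) (T : ℝ) (hT : 0 < T) (s : ℝ) (hs : 1 < s)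
    (u : ℝ → EulerAlpha.Torus L n → EulerAlpha.Vec n)
    (hu : EulerAlpha.IsWeakSolution α T u) (hB : EulerAlpha.MemL3Besov T s u) :
    ∀ t ∈ Set.Ico (0 : ℝ) T,
      EulerAlpha.hamiltonian α (u t) = EulerAlpha.hamiltonian α (u 0) := by
  intro t ht
  rcases ht.1.eq_or_lt with h0 | h0
  · rw [← h0]
  -- The energy is constant on `(0, T)` and continuous up to the initial time.
  have hconst : ∀ r ∈ Set.Ioo (0 : ℝ) T,
      EulerAlpha.hamiltonian α (u r) = EulerAlpha.hamiltonian α (u t) := by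
    intro r hr
    rcases le_total r t with h | h
    · exact EulerAlpha.hamiltonian_eq_of_mem_Ioo hT hs hu hB hr.1 h ht.2
    · exact (EulerAlpha.hamiltonian_eq_of_mem_Ioo hT hs hu hB h0 h hr.2).symm
  have hcont := (hu.continuous_h1.continuousOn_hamiltonian α) 0 ⟨le_rfl, hT⟩
  have h1 := hcont.mono Set.Ioo_subset_Ico_self
  have h2 : Filter.Tendsto (fun r => EulerAlpha.hamiltonian α (u r))
      (nhdsWithin 0 (Set.Ioo 0 T)) (nhds (EulerAlpha.hamiltonian α (u t))) :=
    tendsto_const_nhds.congr' (eventually_mem_nhdsWithin.mono fun r hr => (hconst r hr).symm)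
  have : (nhdsWithin (0 : ℝ) (Set.Ioo 0 T)).NeBot := left_nhdsWithin_Ioo_neBot hT
  exact tendsto_nhds_unique h2 h1
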